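/- Let $\Omega\subset\mathbb{R}^d$ be a bounded domain (no regularity of $\partial\Omega$ is needed), let $T>0$ and let $M\in C([0,T]\times[0,T])$ be real valued. Let $H_0^1(\Omega)$ be the closure of $C_c^\infty(\Omega)$ in the norm $|f|_{H_0^1(\Omega)}^2=|f|_{L^2(\Omega)}^2+|\nabla f|_{L^2(\Omega)}^2$. Then there is a constant $C>0$, depending only on $\Omega$, $T$ and $M$, such that the following holds. Let $O(t)\subset\Omega$, $t\in(0,T)$, be sets such that $O=\{(t,x)\mid t\in(0,T),\ x\in O(t)\}$ is measurable. For any $(y_0,y_1)\in H_0^1(\Omega)\times L^2(\Omega)$ and any $u\in L^2(O)$, the system $$ \begin{cases} y_{tt}-\Delta y+\displaystyle\int_0^t M(t,s)\,y(s)\,ds=\chi_{O(t)}u & \text{in }(0,T)\times\Omega,\\ y=0 & \text{on }(0,T)\times\partial\Omega,\\ y(0)=y_0,\quad y_t(0)=y_1 & \text{in }\Omega \end{cases} $$ has a unique weak solution $y\in C([0,T];H_0^1(\Omega))\cap C^1([0,T];L^2(\Omega))$, and $$ \Big(\sup_{t\in[0,T]}|y(t)|_{H_0^1(\Omega)}^2+\sup_{t\in[0,T]}|y_t(t)|_{L^2(\Omega)}^2\Big)^{1/2}\le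 C\Big(\big(|y_0|_{H_0^1(\Omega)}^2+|y_1|_{L^2(\Omega)}^2\big)^{1/2}+|u|_{L^2(O)}\Big). $$ Here $y$ is a weak solution if $y(0)=y_0$, $y_t(0)=y_1$ and, for every $v\in H_0^1(\Omega)$ and every $t\in[0,T]$, $$ \langle y_t(t),v\rangle-\langle y_1,v\rangle+\int_0^t\Big(\langle\nabla y(s),\nabla v\rangle+\Big\langle\int_0^s M(s,r)y(r)\,dr,\,v\Big\rangle\Big)ds=\int_0^t\!\int_{O(s)}u(s,x)\,v(x)\,dx\,ds, $$ with $\langle\cdot,\cdot\rangle$ the inner product of $L^2(\Omega)$. -/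

import Mathlib

open MeasureTheory Set
open scoped ContDiff

noncomputable section

namespace MemoryWave

/-- The Euclidean space `ℝ^d`. -/
abbrev Space (d : ℕ) : Type := EuclideanSpace ℝ (Fin d)

/-- The real Hilbert space `L²(Ω)`. -/
abbrev L2 {d : ℕ} (Ω : Set (Space d)) : Type :=
  Lp ℝ 2 (volume.restrict Ω)

/-- The real Hilbert space `L²(Ω; ℝ^d)` of square integrable vector fields. -/
abbrev L2Vec {d : ℕ} (Ω : Set (Space d)) : Type :=
  Lp (Space d) 2 (volume.restrict Ω)

/-- The Hilbert space of pairs `(f, g)` in `L²(Ω) × L²(Ω; ℝ^d)`, with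
`‖(f, g)‖² = ‖f‖² + ‖g‖²`. -/
abbrev L2Pair {d : ℕ} (Ω : Set (Space d)) : Type :=
  WithLp 2 (L2 Ω × L2Vec Ω)

/-- `φ` is a test function on `Ω`: smooth, with compact support contained in `Ω`. -/
structure IsTestFunction {d : ℕ} (Ω : Set (Space d)) (φ : Space d → ℝ) : Prop where
  smooth : ContDiff ℝ ∞ φ
  compact : HasCompactSupport φ
  support_subset : tsupport φ ⊆ Ω

/-- The pairs `(φ, ∇φ)` with `φ` a test function on `Ω`, as classes of functions. -/
def testPairs {d : ℕ} (Ω : Set (Space d)) : Submodule ℝ (L2Pair Ω) where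
  carrier := {p | ∃ φ : Space d → ℝ, IsTestFunction Ω φ ∧
    p.fst =ᵐ[volume.restrict Ω] φ ∧ p.snd =ᵐ[volume.restrict Ω] gradient φ}
  zero_mem' := by
    refine ⟨0, ⟨contDiff_const, HasCompactSupport.zero, by simp [tsupport]⟩, ?_, ?_⟩
    · exact Lp.coeFn_zero _ _ _
    · have h : gradient (0 : Space d → ℝ) = 0 := by
        funext x
        exact gradient_const x (0 : ℝ)
      rw [h]
      exact Lp.coeFn_zero _ _ _
  add_mem' := by
    rintro p q ⟨φ, hφ, h1, h2⟩ ⟨ψ, hψ, k1, k2⟩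
    refine ⟨φ + ψ, ⟨hφ.smooth.add hψ.smooth, hφ.compact.add hψ.compact, ?_⟩, ?_, ?_⟩
    · exact (tsupport_add φ ψ).trans (union_subset hφ.support_subset hψ.support_subset)
    · exact (Lp.coeFn_add p.fst q.fst).trans (h1.add k1)
    · have h : gradient (φ + ψ) = gradient φ + gradient ψ := by
        funext x
        simp only [gradient, Pi.add_apply]
        rw [fderiv_add (hφ.smooth.differentiable (by simp) x)
          (hψ.smooth.differentiable (by simp) x), map_add]
      rw [h]
      exact (Lp.coeFn_add p.snd q.snd).trans (h2.add k2)
  smul_mem' := by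
    rintro c p ⟨φ, hφ, h1, h2⟩
    refine ⟨c • φ, ⟨contDiff_const.smul hφ.smooth, hφ.compact.smul_left (f := fun _ => c), ?_⟩,
      ?_, ?_⟩
    · exact (closure_mono (Function.support_const_smul_subset c φ)).trans hφ.support_subset
    · exact (Lp.coeFn_smul c p.fst).trans (h1.const_smul c)
    · have h : gradient (c • φ) = c • gradient φ := by
        funext x
        simp only [gradient, Pi.smul_apply]
        rw [fderiv_const_smul (hφ.smooth.differentiable (by simp) x), map_smul]
      rw [h]
      exact (Lp.coeFn_smul c p.snd).trans (h2.const_smul c)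

/-- The Sobolev space `H₀¹(Ω)`: the closure of the test functions on `Ω` in the norm
`(‖f‖²_{L²} + ‖∇f‖²_{L²})^{1/2}`. An element is recorded together with its weak gradient, as the
limit in `L²(Ω) × L²(Ω; ℝ^d)` of pairs `(φₙ, ∇φₙ)`. -/
def H01 {d : ℕ} (Ω : Set (Space d)) : Submodule ℝ (L2Pair Ω) :=
  (testPairs Ω).topologicalClosure

/-- The inclusion `H₀¹(Ω) → L²(Ω)`. -/
def toL2 {d : ℕ} {Ω : Set (Space d)} (f : H01 Ω) : L2 Ω := (f : L2Pair Ω).fst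

/-- The weak gradient `H₀¹(Ω) → L²(Ω; ℝ^d)`. -/
def weakGrad {d : ℕ} {Ω : Set (Space d)} (f : H01 Ω) : L2Vec Ω := (f : L2Pair Ω).snd

/-- The space-time region `{(t, x) | t ∈ (0, T), x ∈ O(t)}` where the control acts. -/
def controlRegion {d : ℕ} (T : ℝ) (O : ℝ → Set (Space d)) : Set (ℝ × Space d) :=
  {p | p.1 ∈ Ioo 0 T ∧ p.2 ∈ O p.1}

/-- The velocity `y_t(t)` of a curve `y` in `H₀¹(Ω)`: the derivative, in the norm of `L²(Ω)`, of
`y` seen as a curve in `L²(Ω)`, one-sided at the endpoints of `[0, T]`. -/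
def velocity {d : ℕ} {Ω : Set (Space d)} (T : ℝ) (y : ℝ → H01 Ω) (t : ℝ) : L2 Ω :=
  derivWithin (fun s => toL2 (y s)) (Icc 0 T) t

/-- `y` is a solution on `[0, T]`, in the class `C([0,T]; H₀¹(Ω)) ∩ C¹([0,T]; L²(Ω))`, of

  `y_tt - Δy + ∫₀ᵗ M(t,s) y(s) ds = χ_{O(t)} u`  in `(0,T) × Ω`,
  `y = 0`  on `(0,T) × ∂Ω`,
  `y(0) = y₀`, `y_t(0) = y₁`  in `Ω`.

The boundary condition is contained in `y(t) ∈ H₀¹(Ω)`. The equation is understood in the usual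
weak sense: for each `v ∈ H₀¹(Ω)`, the function `t ↦ ⟨y_t(t), v⟩` is absolutely continuous and,
for almost every `t`,
`d/dt ⟨y_t(t), v⟩ + ⟨∇y(t), ∇v⟩ + ⟨∫₀ᵗ M(t,s) y(s) ds, v⟩ = ∫_{O(t)} u(t,x) v(x) dx`;
this is written below in its integrated form. Only the values of `y` on `[0, T]` matter. -/
structure IsSolution {d : ℕ} (Ω : Set (Space d)) (T : ℝ) (M : ℝ → ℝ → ℝ)
    (O : ℝ → Set (Space d)) (y₀ : H01 Ω) (y₁ : L2 Ω)
    (u : Lp ℝ 2 (volume.restrict (controlRegion T O))) (y : ℝ → H01 Ω) : Prop where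
  continuousOn : ContinuousOn y (Icc 0 T)
  contDiffOn : ContDiffOn ℝ 1 (fun t => toL2 (y t)) (Icc 0 T)
  initial_position : y 0 = y₀
  initial_velocity : velocity T y 0 = y₁
  equation : ∀ v : H01 Ω, ∀ t ∈ Icc 0 T,
    inner ℝ (velocity T y t) (toL2 v) - inner ℝ (velocity T y 0) (toL2 v)
      + (∫ s in 0..t, (inner ℝ (weakGrad (y s)) (weakGrad v)
          + inner ℝ (∫ r in 0..s, M s r • toL2 (y r)) (toL2 v)))
      = ∫ s in 0..t, ∫ x in O s, u (s, x) * toL2 v x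

/-- The norm of `C([0,T]; H₀¹(Ω)) ∩ C¹([0,T]; L²(Ω))`:
`((sup ‖y(t)‖_{H₀¹})² + (sup ‖y_t(t)‖_{L²})²)^{1/2}`, the suprema being over `t ∈ [0, T]`. -/
def solutionNorm {d : ℕ} {Ω : Set (Space d)} (T : ℝ) (y : ℝ → H01 Ω) : ℝ :=
  Real.sqrt ((⨆ t : Icc (0 : ℝ) T, ‖y t‖) ^ 2 + (⨆ t : Icc (0 : ℝ) T, ‖velocity T y t‖) ^ 2)

end MemoryWave

end

/-! The inner product of H₀¹(Ω) is ⟨y,v⟩ + ⟨∇y,∇v⟩, so adding y to both sides turns the equation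
into y'' + (1-Δ)y = (y - ∫₀ᵗ M(t,s) y(s) ds) + f. The left side is conservative for the H₀¹ energy,
and the bracket is a bounded perturbation with memory.

Let J : V → H be the inclusion of V = H₀¹(Ω) in H = L²(Ω). On pairs U = (y, w) in V × H the free
equation reads K U' = U with K(a, b) = (-J†b, J a). This K is bounded and skew, and it is injective
because J is injective with dense range. It is the inverse of the unbounded wave generator, so
working with K needs neither operator domains nor a regular boundary. Yosida-type approximation
produces the isometry group S generated by K⁻¹ (`IsSkew.exists_group`).

Existence: Duhamel's formula gives a Volterra fixed point equation for U. It is solved by a Neumann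
series that converges because the Volterra operator contracts a norm weighted by e^{-lt}
(`IsGroupOfInverse.exists_mild`). The components of the equation, integrated in time with K applied
to it, are the weak form (`exists_wave`).

Uniqueness: the difference D of two solutions is only continuous in V × H, so its energy cannot be
differentiated. But K D is C¹, skewness removes the term ⟨K D, D⟩, and J y is a component of K D. A
Gronwall argument for ‖K D‖² then closes (`IsSkew.eq_zero_of_integral_eq`).

The control enters only through the L¹ norm in time of its slices, at most √T ‖u‖ whatever the sets
O(t) (`exists_forcing`). Hence the constant does not depend on O. -/

section

open Filter Topology

/-! ### Isometry groups generated by the inverse of a bounded skew operator. -/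

section SkewGroup

variable {E : Type*} [NormedAddCommGroup E] [InnerProductSpace ℝ E]

/-- A bounded operator `A` on a real inner product space with `A† = -A`. -/
def IsSkew (A : E →L[ℝ] E) : Prop := ∀ x y, inner ℝ (A x) y = -inner ℝ x (A y)

theorem IsSkew.inner_self {A : E →L[ℝ] E} (hA : IsSkew A) (x : E) : inner ℝ (A x) x = 0 := by
  have h := hA x x
  rw [real_inner_comm (A x) x] at h
  linarith

theorem IsSkew.sub {A B : E →L[ℝ] E} (hA : IsSkew A) (hB : IsSkew B) : IsSkew (A - B) := by
  intro x y
  simp only [sub_apply, inner_sub_left, inner_sub_right, hA x y, hB x y]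
  ring

variable [CompleteSpace E]

theorem hasDerivAt_exp_smul_apply (A : E →L[ℝ] E) (x : E) (t : ℝ) :
    HasDerivAt (fun s : ℝ => NormedSpace.exp (s • A) x) (A (NormedSpace.exp (t • A) x)) t :=
  (hasDerivAt_exp_smul_const' A t).clm_apply (hasDerivAt_const t x) |>.congr_deriv (by simp)

/-- The derivative of ‖e^{sA}x‖² is 2⟨e^{sA}x, A e^{sA}x⟩, which vanishes by skewness. -/
theorem IsSkew.norm_exp_apply {A : E →L[ℝ] E} (hA : IsSkew A) (t : ℝ) (x : E) :
    ‖NormedSpace.exp (t • A) x‖ = ‖x‖ := by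
  have h : ∀ s : ℝ, HasDerivAt (fun s : ℝ => ‖NormedSpace.exp (s • A) x‖ ^ 2) 0 s := fun s => by
    convert (hasDerivAt_exp_smul_apply A x s).norm_sq using 1
    rw [real_inner_comm, hA.inner_self, mul_zero]
  have h2 := is_const_of_deriv_eq_zero (fun s => (h s).differentiableAt) (fun s => (h s).deriv) t 0
  simp only [zero_smul, NormedSpace.exp_zero, one_apply_eq_self] at h2
  exact (pow_left_inj₀ (norm_nonneg _) (norm_nonneg _) two_ne_zero).1 h2

theorem exp_add_smul (A : E →L[ℝ] E) (s t : ℝ) :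
    NormedSpace.exp ((s + t) • A) = NormedSpace.exp (s • A) * NormedSpace.exp (t • A) := by
  let : NormedAlgebra ℚ (E →L[ℝ] E) := NormedAlgebra.restrictScalars ℚ ℝ _
  rw [add_smul]
  exact NormedSpace.exp_add_of_commute (((Commute.refl A).smul_left s).smul_right t)

omit [CompleteSpace E] in
theorem commute_exp_smul {A B : E →L[ℝ] E} (h : Commute A B) (t : ℝ) :
    Commute A (NormedSpace.exp (t • B)) := (h.smul_right t).exp_right

/-- The speed A e^{sA}x = e^{sA}Ax has constant norm ‖Ax‖. The bound thus involves A only through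
Ax, which matters because the approximants used later are not bounded uniformly in operator norm. -/
theorem IsSkew.norm_exp_apply_sub_le {A : E →L[ℝ] E} (hA : IsSkew A) (t : ℝ) (x : E) :
    ‖NormedSpace.exp (t • A) x - x‖ ≤ ‖A x‖ * |t| := by
  have h := Convex.norm_image_sub_le_of_norm_hasDerivWithin_le (𝕜 := ℝ) (s := univ) (x := 0)
    (y := t) (C := ‖A x‖) (fun s _ => (hasDerivAt_exp_smul_apply A x s).hasDerivWithinAt)
    (fun s _ => le_of_eq ?_) convex_univ (mem_univ _) (mem_univ _)
  · simpa using h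
  · have := DFunLike.congr_fun (commute_exp_smul (Commute.refl A) s).eq x
    simp only [mul_apply_eq_comp] at this
    rw [this, hA.norm_exp_apply]

theorem IsSkew.norm_exp_sub_exp_le {A B : E →L[ℝ] E} (hA : IsSkew A) (hB : IsSkew B)
    (h : Commute A B) (t : ℝ) (x : E) :
    ‖NormedSpace.exp (t • A) x - NormedSpace.exp (t • B) x‖ ≤ ‖A x - B x‖ * |t| := by
  let : NormedAlgebra ℚ (E →L[ℝ] E) := NormedAlgebra.restrictScalars ℚ ℝ _
  have h1 : NormedSpace.exp (t • A)
      = NormedSpace.exp (t • B) * NormedSpace.exp (t • (A - B)) := by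
    rw [← NormedSpace.exp_add_of_commute]
    · congr 1
      rw [smul_sub]
      abel
    · exact ((h.symm.sub_right (Commute.refl B)).smul_left t).smul_right t
  rw [h1, mul_apply_eq_comp, ← map_sub, hB.norm_exp_apply]
  exact (hA.sub hB).norm_exp_apply_sub_le t x

/-- Bounded skew operators, commuting with everything that commutes with `K`, that approximate
the unbounded inverse of the skew operator `K` on the range of `K²`. -/
theorem IsSkew.exists_yosida {K : E →L[ℝ] E} (hK : IsSkew K) {ε : ℝ} (hε : 0 < ε) :
    ∃ G : E →L[ℝ] E, IsSkew G ∧ (∀ B : E →L[ℝ] E, Commute B K → Commute B G) ∧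
      ∀ z, ‖G (K (K z)) - K z‖ ≤ ε * ‖z‖ := by
  -- Skewness makes P coercive: ⟨Px, x⟩ = ε²‖x‖² + ‖Kx‖². With Q = P⁻¹ the witness is G = -KQ,
  -- formally -K(-K²)⁻¹ = K⁻¹ as ε → 0.
  set P : E →L[ℝ] E := (ε ^ 2) • 1 - K * K with hP
  have hPx : ∀ x, P x = ε ^ 2 • x - K (K x) := fun x => by simp [hP]
  have hin : ∀ x, inner ℝ (P x) x = ε ^ 2 * ‖x‖ ^ 2 + ‖K x‖ ^ 2 := fun x => by
    rw [hPx, inner_sub_left, real_inner_smul_left, hK, real_inner_self_eq_norm_sq,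
      real_inner_self_eq_norm_sq]
    ring
  have hunit : IsUnit P := by
    refine ContinuousLinearMap.isUnit_of_forall_le_norm_inner_map P (c := (ε ^ 2).toNNReal)
      (Real.toNNReal_pos.2 (by positivity)) fun x => ?_
    rw [hin, Real.norm_of_nonneg (by positivity), Real.coe_toNNReal _ (by positivity)]
    nlinarith [sq_nonneg ‖K x‖]
  obtain ⟨U, hU⟩ := hunit
  set Q : E →L[ℝ] E := ((U⁻¹ : (E →L[ℝ] E)ˣ) : E →L[ℝ] E) with hQ
  have hPQ : ∀ x, P (Q x) = x := fun x => by
    have : P * Q = 1 := by rw [← hU, hQ, Units.mul_inv]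
    exact DFunLike.congr_fun this x
  have hQP : ∀ x, Q (P x) = x := fun x => by
    have : Q * P = 1 := by rw [← hU, hQ, Units.inv_mul]
    exact DFunLike.congr_fun this x
  have hcomm : ∀ B : E →L[ℝ] E, Commute B K → Commute B Q := fun B hB => by
    have : Commute B P := by
      rw [hP]
      exact ((Commute.one_right B).smul_right _).sub_right (hB.mul_right hB)
    rw [← hU] at this
    exact this.units_inv_right
  have hKQ : ∀ x, K (Q x) = Q (K x) := fun x =>
    DFunLike.congr_fun (hcomm K (Commute.refl K)).eq x
  have hPs : ∀ x y, inner ℝ (P x) y = inner ℝ x (P y) := fun x y => by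
    rw [hPx, hPx, inner_sub_left, inner_sub_right, real_inner_smul_left, real_inner_smul_right,
      hK, hK]
    ring
  have hQs : ∀ x y, inner ℝ (Q x) y = inner ℝ x (Q y) := fun x y => by
    conv_lhs => rw [← hPQ y]
    rw [← hPs, hPQ]
  refine ⟨-(K * Q), fun x y => ?_, fun B hB => (hB.mul_right (hcomm B hB)).neg_right, fun z => ?_⟩
  · simp only [neg_apply, mul_apply_eq_comp, inner_neg_left, inner_neg_right, hKQ, hQs, hK x]
  · have h1 : (-(K * Q)) (K (K z)) - K z = -(ε ^ 2 • K (Q z)) := by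
      have h2 : K (K z) = ε ^ 2 • z - P z := by rw [hPx]; abel
      rw [neg_apply, mul_apply_eq_comp, h2, map_sub, hQP,
        map_sub, map_smul, map_smul]
      abel
    rw [h1, norm_neg, norm_smul, Real.norm_of_nonneg (by positivity)]
    -- With w = Qz one has ε²‖w‖² + ‖Kw‖² = ⟨z, w⟩. Multiplying by ε² and completing the square
    -- gives ε‖Kw‖ ≤ ‖z‖, so the error ε²Kw has norm at most ε‖z‖.
    have h3 := hin (Q z)
    rw [hPQ] at h3
    have h4 : inner ℝ z (Q z) ≤ ‖z‖ * ‖Q z‖ := real_inner_le_norm _ _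
    have h6 : ε ^ 2 * ‖K (Q z)‖ ^ 2 ≤ ‖z‖ ^ 2 := by
      nlinarith [sq_nonneg (‖z‖ - 2 * ε ^ 2 * ‖Q z‖), sq_nonneg ‖z‖, sq_nonneg ε]
    have h7 : ε * ‖K (Q z)‖ ≤ ‖z‖ := by
      apply le_of_sq_le_sq _ (norm_nonneg _)
      rw [mul_pow]; exact h6
    nlinarith

/-- A strongly continuous group `S` of isometries whose generator is the inverse of `K`. -/
structure IsGroupOfInverse (K : E →L[ℝ] E) (S : ℝ → E →L[ℝ] E) : Prop where
  zero : S 0 = 1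
  add : ∀ s t, S (s + t) = S s * S t
  norm_apply : ∀ t x, ‖S t x‖ = ‖x‖
  continuous : ∀ x, Continuous fun t => S t x
  comm : ∀ t x, K (S t x) = S t (K x)
  integral : ∀ t x, K (S t x) - K x = ∫ s in (0 : ℝ)..t, S s x

/-- The exponentials of commuting skew approximants Gₙ of K⁻¹ are isometries. They therefore
converge strongly everywhere once they converge on the range of K², where Gₙ itself converges; that
range is dense because the range of K is. -/
theorem IsSkew.exists_group {K : E →L[ℝ] E} (hK : IsSkew K) (hd : DenseRange K) :
    ∃ S : ℝ → E →L[ℝ] E, IsGroupOfInverse K S := by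
  have hpos : ∀ n : ℕ, (0 : ℝ) < 1 / ((n : ℝ) + 1) := fun n => Nat.one_div_pos_of_nat
  choose G hG hGc hGK using fun n : ℕ => hK.exists_yosida (hpos n)
  have hGG : ∀ m n, Commute (G m) (G n) := fun m n =>
    hGc n _ (hGc m K (Commute.refl K)).symm
  have hd2 : DenseRange fun z => K (K z) := hd.comp hd K.continuous
  set R : ℕ → ℝ → E →L[ℝ] E := fun n t => NormedSpace.exp (t • G n) with hR
  have hRn : ∀ n t x, ‖R n t x‖ = ‖x‖ := fun n t x => (hG n).norm_exp_apply t x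
  have hcau : ∀ t x, CauchySeq fun n => R n t x := by
    intro t x
    rw [Metric.cauchySeq_iff']
    intro ε hε
    obtain ⟨z, hz⟩ := hd2.exists_dist_lt x (show 0 < ε / 3 by positivity)
    rw [dist_eq_norm] at hz
    obtain ⟨N, hN⟩ := exists_nat_one_div_lt (show 0 < ε / 3 / (2 * ‖z‖ * |t| + 1) by positivity)
    refine ⟨N, fun n hn => ?_⟩
    have h1 : ‖R n t (K (K z)) - R N t (K (K z))‖ < ε / 3 := by
      have h2 := (hG n).norm_exp_sub_exp_le (hG N) (hGG n N) t (K (K z))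
      have h3 : ‖G n (K (K z)) - G N (K (K z))‖ ≤ 1 / ((N : ℝ) + 1) * (2 * ‖z‖) := by
        have h4 : 1 / ((n : ℝ) + 1) ≤ 1 / ((N : ℝ) + 1) := Nat.one_div_le_one_div hn
        calc _ = ‖(G n (K (K z)) - K z) - (G N (K (K z)) - K z)‖ := by congr 1; abel
          _ ≤ _ := norm_sub_le _ _
          _ ≤ 1 / ((n : ℝ) + 1) * ‖z‖ + 1 / ((N : ℝ) + 1) * ‖z‖ := add_le_add (hGK n z) (hGK N z)
          _ ≤ _ := by nlinarith [norm_nonneg z]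
      rw [lt_div_iff₀ (by positivity)] at hN
      have h5 := hpos N
      have h6 := mul_le_mul_of_nonneg_right h3 (abs_nonneg t)
      calc _ ≤ _ := h2
        _ ≤ _ := h6
        _ < _ := by nlinarith
    rw [dist_eq_norm]
    calc ‖R n t x - R N t x‖ = ‖R n t (x - K (K z)) + (R n t (K (K z)) - R N t (K (K z)))
          - R N t (x - K (K z))‖ := by rw [map_sub, map_sub]; congr 1; abel
      _ ≤ ‖R n t (x - K (K z))‖ + ‖R n t (K (K z)) - R N t (K (K z))‖
          + ‖R N t (x - K (K z))‖ := (norm_sub_le _ _).trans (by gcongr; exact norm_add_le _ _)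
      _ < ε := by rw [hRn, hRn]; linarith
  choose f hf using fun t x => cauchySeq_tendsto_of_complete (hcau t x)
  set S : ℝ → E →L[ℝ] E := fun t => continuousLinearMapOfTendsto (R · t) (f := f t)
    (tendsto_pi_nhds.2 (hf t)) with hS
  have hlim : ∀ t x, Tendsto (fun n => R n t x) atTop (𝓝 (S t x)) := hf
  have hnorm : ∀ t x, ‖S t x‖ = ‖x‖ := fun t x =>
    tendsto_nhds_unique (hlim t x).norm (by simp only [hRn]; exact tendsto_const_nhds)
  have hzero : S 0 = 1 := by
    ext x
    refine tendsto_nhds_unique (hlim 0 x) ?_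
    simp [hR]
  have hadd : ∀ s t, S (s + t) = S s * S t := by
    intro s t
    ext x
    refine tendsto_nhds_unique (hlim (s + t) x) ?_
    have h1 : ∀ n, R n (s + t) x = R n s (S t x) + R n s (R n t x - S t x) := fun n => by
      simp only [hR, exp_add_smul, mul_apply_eq_comp, map_sub]
      abel
    simp only [h1, mul_apply_eq_comp]
    rw [← add_zero (S s (S t x))]
    refine (hlim s (S t x)).add ?_
    rw [tendsto_zero_iff_norm_tendsto_zero]
    simp only [hRn]
    rw [← tendsto_zero_iff_norm_tendsto_zero, tendsto_sub_nhds_zero_iff]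
    exact hlim t x
  have hcomm : ∀ t x, K (S t x) = S t (K x) := fun t x => by
    refine tendsto_nhds_unique ((K.continuous.tendsto _).comp (hlim t x)) ?_
    convert hlim t (K x) using 2 with n
    exact DFunLike.congr_fun (commute_exp_smul (hGc n K (Commute.refl K)) t).eq x
  have hGlim : ∀ z, Tendsto (fun n => G n (K (K z))) atTop (𝓝 (K z)) := fun z => by
    rw [tendsto_iff_norm_sub_tendsto_zero]
    refine squeeze_zero (fun n => norm_nonneg _) (fun n => hGK n z) ?_
    simpa using (tendsto_one_div_add_atTop_nhds_zero_nat (𝕜 := ℝ)).mul_const ‖z‖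
  have hlip : ∀ z t, ‖S t (K (K z)) - K (K z)‖ ≤ ‖K z‖ * |t| := fun z t =>
    le_of_tendsto_of_tendsto' ((hlim t (K (K z))).sub_const _).norm
      ((hGlim z).norm.mul_const |t|) fun n => (hG n).norm_exp_apply_sub_le t _
  have hcont0 : ∀ x, Tendsto (fun t => S t x) (𝓝 0) (𝓝 x) := by
    intro x
    rw [Metric.tendsto_nhds]
    intro ε hε
    obtain ⟨z, hz⟩ := hd2.exists_dist_lt x (show 0 < ε / 3 by positivity)
    rw [dist_eq_norm] at hz
    have h0 : Tendsto (fun t : ℝ => ‖K z‖ * |t|) (𝓝 0) (𝓝 0) := by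
      have : Continuous fun t : ℝ => ‖K z‖ * |t| := by fun_prop
      simpa using this.tendsto 0
    filter_upwards [h0.eventually (gt_mem_nhds (show 0 < ε / 3 by positivity))] with t ht
    rw [dist_eq_norm]
    calc ‖S t x - x‖ = ‖S t (x - K (K z)) + (S t (K (K z)) - K (K z)) - (x - K (K z))‖ := by
          rw [map_sub]; congr 1; abel
      _ ≤ ‖S t (x - K (K z))‖ + ‖S t (K (K z)) - K (K z)‖ + ‖x - K (K z)‖ :=
          (norm_sub_le _ _).trans (by gcongr; exact norm_add_le _ _)
      _ < ε := by rw [hnorm]; linarith [hlip z t]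
  have hcont : ∀ x, Continuous fun t => S t x := by
    intro x
    rw [continuous_iff_continuousAt]
    intro t
    have h1 : Tendsto (fun s => s - t) (𝓝 t) (𝓝 0) := by
      have : Continuous fun s : ℝ => s - t := by fun_prop
      simpa using this.tendsto t
    have h2 := ((S t).continuous.tendsto x).comp ((hcont0 x).comp h1)
    refine h2.congr fun s => ?_
    change S t (S (s - t) x) = S s x
    rw [← mul_apply_eq_comp, ← hadd]
    congr 2
    ring
  refine ⟨S, hzero, hadd, hnorm, hcont, hcomm, fun t => ?_⟩
  -- On the range of K² this is the limit of the fundamental theorem of calculus for e^{sGₙ}, with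
  -- Gₙ K² z → K z and dominated convergence. Density of the range of K then yields the integral
  -- identity for all vectors.
  have hcore : ∀ z, S t (K (K z)) - K (K z) = ∫ s in (0 : ℝ)..t, S s (K z) := by
    intro z
    have h1 : ∀ n, ∫ s in (0 : ℝ)..t, R n s (G n (K (K z))) = R n t (K (K z)) - K (K z) := by
      intro n
      have hsw : ∀ s, R n s (G n (K (K z))) = G n (R n s (K (K z))) := fun s =>
        (DFunLike.congr_fun (commute_exp_smul (Commute.refl (G n)) s).eq _).symm
      have := intervalIntegral.integral_eq_sub_of_hasDerivAt (a := 0) (b := t)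
        (fun s _ => hasDerivAt_exp_smul_apply (G n) (K (K z)) s) ?_
      · simp only [hsw]
        rw [this]
        simp [hR]
      · refine Continuous.intervalIntegrable (continuous_iff_continuousAt.2 fun s => ?_) _ _
        exact (G n).continuous.continuousAt.comp
          (hasDerivAt_exp_smul_apply (G n) (K (K z)) s).continuousAt
    have hRc : ∀ n x, Continuous fun s => R n s x := fun n x =>
      continuous_iff_continuousAt.2 fun s => (hasDerivAt_exp_smul_apply (G n) x s).continuousAt
    refine tendsto_nhds_unique ((hlim t (K (K z))).sub_const _) ?_
    simp only [← h1]
    refine intervalIntegral.tendsto_integral_filter_of_dominated_convergence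
      (fun _ => ‖K z‖ + ‖z‖) (Eventually.of_forall fun n => (hRc n _).aestronglyMeasurable)
      (Eventually.of_forall fun n => Eventually.of_forall fun s _ => ?_)
      intervalIntegrable_const (Eventually.of_forall fun s _ => ?_)
    · rw [hRn]
      have h2 := hGK n z
      have h3 : 1 / ((n : ℝ) + 1) ≤ 1 := by
        rw [div_le_one (by positivity)]; linarith [(Nat.cast_nonneg n : (0 : ℝ) ≤ n)]
      calc _ = ‖K z + (G n (K (K z)) - K z)‖ := by congr 1; abel
        _ ≤ ‖K z‖ + ‖G n (K (K z)) - K z‖ := norm_add_le _ _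
        _ ≤ _ := by nlinarith [norm_nonneg z]
    · have h2 : ∀ n, R n s (G n (K (K z))) = R n s (K z) + R n s (G n (K (K z)) - K z) :=
        fun n => by rw [map_sub]; abel
      simp only [h2]
      rw [← add_zero (S s (K z))]
      refine (hlim s (K z)).add ?_
      rw [tendsto_zero_iff_norm_tendsto_zero]
      simp only [hRn]
      rw [← tendsto_zero_iff_norm_tendsto_zero, tendsto_sub_nhds_zero_iff]
      exact hGlim z
  refine fun x => hd.induction_on (p := fun x => K (S t x) - K x = ∫ s in (0 : ℝ)..t, S s x) x
    (isClosed_eq ?_ ?_) fun z => ?_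
  · fun_prop
  · refine LipschitzWith.continuous (K := ‖t‖₊) (LipschitzWith.of_dist_le_mul ?_)
    intro x y
    rw [dist_eq_norm, dist_eq_norm, ← intervalIntegral.integral_sub
      ((hcont x).intervalIntegrable _ _) ((hcont y).intervalIntegrable _ _)]
    refine (intervalIntegral.norm_integral_le_of_norm_le_const (C := ‖x - y‖) fun s _ => ?_).trans
      (le_of_eq ?_)
    · rw [← map_sub, hnorm]
    · simp [mul_comm]
  · rw [hcomm]
    exact hcore z

end SkewGroup

/-! ### Duhamel's formula for `K U' = U + K N`, in integrated form. -/

section Duhamel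

variable {E : Type*} [NormedAddCommGroup E] [InnerProductSpace ℝ E] [CompleteSpace E]
  {K : E →L[ℝ] E} {S : ℝ → E →L[ℝ] E}

namespace IsGroupOfInverse

omit [CompleteSpace E] in
theorem neg_apply_apply (hS : IsGroupOfInverse K S) (t : ℝ) (x : E) : S t (S (-t) x) = x := by
  rw [← mul_apply_eq_comp, ← hS.add, add_neg_cancel, hS.zero, one_apply_eq_self]

omit [CompleteSpace E] in
theorem inner_apply_left (hS : IsGroupOfInverse K S) (t : ℝ) (x y : E) :
    inner ℝ (S t x) y = inner ℝ x (S (-t) y) := by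
  conv_lhs => rw [← hS.neg_apply_apply t y]
  exact (⟨(S t : E →ₗ[ℝ] E), hS.norm_apply t⟩ : E →ₗᵢ[ℝ] E).inner_map_map _ _

omit [CompleteSpace E] in
theorem continuous_uncurry (hS : IsGroupOfInverse K S) :
    Continuous fun p : ℝ × E => S p.1 p.2 := by
  rw [continuous_iff_continuousAt]
  rintro ⟨t, x⟩
  have h1 : ∀ p : ℝ × E, S p.1 p.2 = S p.1 (p.2 - x) + S p.1 x := fun p => by
    rw [map_sub, sub_add_cancel]
  refine Tendsto.congr (fun p => (h1 p).symm) ?_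
  change Tendsto _ _ (𝓝 (S t x))
  rw [← zero_add (S t x)]
  refine Tendsto.add ?_ (((hS.continuous x).comp continuous_fst).tendsto _)
  rw [tendsto_zero_iff_norm_tendsto_zero]
  simp only [hS.norm_apply]
  have : Continuous fun p : ℝ × E => ‖p.2 - x‖ := by fun_prop
  simpa using this.tendsto (t, x)

omit [CompleteSpace E] in
theorem continuous_apply (hS : IsGroupOfInverse K S) {g : ℝ → ℝ} {u : ℝ → E} (hg : Continuous g)
    (hu : Continuous u) : Continuous fun t => S (g t) (u t) :=
  hS.continuous_uncurry.comp (hg.prodMk hu)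

omit [CompleteSpace E] in
theorem intervalIntegrable_apply (hS : IsGroupOfInverse K S) {g : ℝ → ℝ} {N : ℝ → E} {a b : ℝ}
    (hg : Continuous g) (hN : IntervalIntegrable N volume a b) :
    IntervalIntegrable (fun s => S (g s) (N s)) volume a b := by
  rw [intervalIntegrable_iff] at hN ⊢
  refine Integrable.mono hN ?_ (Eventually.of_forall fun s => (hS.norm_apply _ _).le)
  exact hS.continuous_uncurry.comp_aestronglyMeasurable
    (hg.aestronglyMeasurable.prodMk hN.aestronglyMeasurable)

omit [CompleteSpace E] in
theorem integrable_apply (hS : IsGroupOfInverse K S) {g : ℝ → ℝ} {N : ℝ → E}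
    (hg : Continuous g) (hN : Integrable N) : Integrable fun s => S (g s) (N s) :=
  hN.mono (hS.continuous_uncurry.comp_aestronglyMeasurable
    (hg.aestronglyMeasurable.prodMk hN.aestronglyMeasurable))
    (Eventually.of_forall fun _ => (hS.norm_apply _ _).le)

theorem hasDerivAt (hS : IsGroupOfInverse K S) (x : E) (t : ℝ) :
    HasDerivAt (fun t => K (S t x)) (S t x) t := by
  have h1 : (fun t => K (S t x)) = fun t => K x + ∫ s in (0 : ℝ)..t, S s x := by
    funext t
    rw [← hS.integral]
    abel
  rw [h1]
  exact ((hS.continuous x).integral_hasStrictDerivAt 0 t).hasDerivAt.const_add _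

/-- The identity `K U(t) = ∫₀ᵗ U + K ∫₀ᵗ S n` for `U(t) = S(t) ∫₀ᵗ n`, with `n` continuous. -/
theorem integral_of_continuous (hS : IsGroupOfInverse K S) {n : ℝ → E} (hn : Continuous n)
    (t : ℝ) :
    K (S t (∫ s in (0 : ℝ)..t, n s))
      = (∫ τ in (0 : ℝ)..t, S τ (∫ s in (0 : ℝ)..τ, n s)) + K (∫ s in (0 : ℝ)..t, S s (n s)) := by
  set P : ℝ → E := fun τ => ∫ s in (0 : ℝ)..τ, n s with hP
  have hPd : ∀ τ, HasDerivAt P (n τ) τ := fun τ => (hn.integral_hasStrictDerivAt 0 τ).hasDerivAt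
  have hPc : Continuous P := continuous_iff_continuousAt.2 fun τ => (hPd τ).continuousAt
  -- Skewness of K is recovered from the group: ⟨K S(s)x, K S(s)y⟩ is constant in s, and its
  -- derivative at 0 is ⟨x, Ky⟩ + ⟨Kx, y⟩.
  have hK : ∀ x y, inner ℝ (K x) y = -inner ℝ x (K y) := by
    intro x y
    have h1 : HasDerivAt (fun s => inner ℝ (K (S s x)) (K (S s y)))
        (inner ℝ (K x) y + inner ℝ x (K y)) 0 := by
      have := (hS.hasDerivAt x 0).inner ℝ (hS.hasDerivAt y 0)
      simpa only [hS.zero, one_apply_eq_self] using this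
    have h2 : (fun s => inner ℝ (K (S s x)) (K (S s y))) = fun _ => inner ℝ (K x) (K y) := by
      funext s
      rw [hS.comm, hS.comm, hS.inner_apply_left]
      congr 1
      simpa using hS.neg_apply_apply (-s) (K y)
    rw [h2] at h1
    linarith [h1.unique (hasDerivAt_const 0 _)]
  refine ext_inner_right ℝ fun z => ?_
  -- S(τ)P(τ) need not be differentiable. Tested against z, K and S move to the other side: the
  -- pairing is -⟨P(τ), K S(-τ)z⟩, and both factors are differentiable.
  have hd : ∀ τ, HasDerivAt (fun τ => inner ℝ (K (S τ (P τ))) z)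
      (inner ℝ (S τ (P τ) + K (S τ (n τ))) z) τ := by
    intro τ
    have h1 : HasDerivAt (fun τ => K (S (-τ) z)) (-S (-τ) z) τ := by
      exact ((hS.hasDerivAt z (-τ)).scomp τ (hasDerivAt_neg τ)).congr_deriv (by simp)
    have h2 := ((hPd τ).inner ℝ h1).neg
    refine (h2.congr_of_eventuallyEq (Eventually.of_forall fun τ => ?_)).congr_deriv ?_
    · simp only [Pi.neg_apply]
      rw [hK, hS.inner_apply_left, ← hS.comm]
    · rw [inner_add_left, hS.inner_apply_left, hK, hS.inner_apply_left, ← hS.comm, inner_neg_right]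
      ring
  have hc1 : Continuous fun τ => S τ (P τ) :=
    hS.continuous_apply (g := fun t => t) continuous_id hPc
  have hc2 : Continuous fun τ => S τ (n τ) :=
    hS.continuous_apply (g := fun t => t) continuous_id hn
  have hc3 : Continuous fun τ => K (S τ (n τ)) := K.continuous.comp hc2
  have h := intervalIntegral.integral_eq_sub_of_hasDerivAt (a := 0) (b := t)
    (fun τ _ => hd τ) (((hc1.add hc3).inner continuous_const).intervalIntegrable _ _)
  have h0 : P 0 = 0 := by simp [hP]
  rw [h0, map_zero, map_zero, inner_zero_left, sub_zero] at h
  rw [← h, ← ContinuousLinearMap.intervalIntegral_comp_comm K (hc2.intervalIntegrable _ _),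
    ← intervalIntegral.integral_add (hc1.intervalIntegrable _ _)
      (hc3.intervalIntegrable _ _)]
  have h3 := ContinuousLinearMap.intervalIntegral_comp_comm (μ := volume) (a := 0) (b := t)
    (innerSL ℝ z) ((hc1.add hc3).intervalIntegrable _ _)
  simp only [innerSL_apply_apply, Pi.add_apply] at h3
  rw [real_inner_comm, ← h3]
  simp only [real_inner_comm]

/-- The defect between the two sides is linear in n and bounded by (2‖K‖ + t) times the L¹ norm of
n. It vanishes for continuous integrable n, so density in L¹ makes it vanish for all integrable n.
-/
theorem integral_of_integrable (hS : IsGroupOfInverse K S) {n : ℝ → E} (hn : Integrable n)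
    {t : ℝ} (ht : 0 ≤ t) :
    K (S t (∫ s in (0 : ℝ)..t, n s))
      = (∫ τ in (0 : ℝ)..t, S τ (∫ s in (0 : ℝ)..τ, n s)) + K (∫ s in (0 : ℝ)..t, S s (n s)) := by
  set D : (ℝ → E) → E := fun n => K (S t (∫ s in (0 : ℝ)..t, n s))
      - ((∫ τ in (0 : ℝ)..t, S τ (∫ s in (0 : ℝ)..τ, n s)) + K (∫ s in (0 : ℝ)..t, S s (n s)))
    with hD
  have hPc : ∀ n : ℝ → E, Integrable n → Continuous fun τ => ∫ s in (0 : ℝ)..τ, n s :=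
    fun n hn => intervalIntegral.continuous_primitive (fun _ _ => hn.intervalIntegrable) 0
  have hPb : ∀ n : ℝ → E, Integrable n → ∀ τ, 0 ≤ τ → ‖∫ s in (0 : ℝ)..τ, n s‖ ≤ ∫ s, ‖n s‖ := by
    intro n hn τ hτ
    refine (intervalIntegral.norm_integral_le_integral_norm hτ).trans ?_
    rw [intervalIntegral.integral_of_le hτ]
    exact setIntegral_le_integral hn.norm (Eventually.of_forall fun s => norm_nonneg _)
  have hb : ∀ n : ℝ → E, Integrable n → ‖D n‖ ≤ (2 * ‖K‖ + t) * ∫ s, ‖n s‖ := by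
    intro n hn
    have h1 : ‖K (S t (∫ s in (0 : ℝ)..t, n s))‖ ≤ ‖K‖ * ∫ s, ‖n s‖ := by
      refine (K.le_opNorm _).trans ?_
      rw [hS.norm_apply]
      gcongr
      exact hPb n hn t ht
    have h2 : ‖∫ τ in (0 : ℝ)..t, S τ (∫ s in (0 : ℝ)..τ, n s)‖ ≤ (∫ s, ‖n s‖) * |t - 0| := by
      refine intervalIntegral.norm_integral_le_of_norm_le_const fun τ hτ => ?_
      rw [hS.norm_apply]
      rw [uIoc_of_le ht] at hτ
      exact hPb n hn τ hτ.1.le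
    have h3 : ‖K (∫ s in (0 : ℝ)..t, S s (n s))‖ ≤ ‖K‖ * ∫ s, ‖n s‖ := by
      refine (K.le_opNorm _).trans ?_
      gcongr
      refine (hPb _ (hS.integrable_apply (g := fun t => t) continuous_id hn) t ht).trans ?_
      simp [hS.norm_apply]
    rw [sub_zero, abs_of_nonneg ht] at h2
    calc _ ≤ _ := norm_sub_le _ _
      _ ≤ _ := add_le_add h1 ((norm_add_le _ _).trans (add_le_add h2 h3))
      _ = _ := by ring
  have hsub : ∀ n g : ℝ → E, Integrable n → Integrable g → D (fun s => n s - g s) = D n - D g := by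
    intro n g hn hg
    have h1 : ∀ τ, ∫ s in (0 : ℝ)..τ, (n s - g s)
        = (∫ s in (0 : ℝ)..τ, n s) - ∫ s in (0 : ℝ)..τ, g s := fun τ =>
      intervalIntegral.integral_sub hn.intervalIntegrable hg.intervalIntegrable
    simp only [hD, h1, map_sub]
    rw [intervalIntegral.integral_sub
        ((hS.continuous_apply (g := fun t => t) continuous_id (hPc n hn)).intervalIntegrable _ _)
        ((hS.continuous_apply (g := fun t => t) continuous_id (hPc g hg)).intervalIntegrable _ _),
      intervalIntegral.integral_sub
        (hS.integrable_apply (g := fun t => t) continuous_id hn).intervalIntegrable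
        (hS.integrable_apply (g := fun t => t) continuous_id hg).intervalIntegrable, map_sub]
    abel
  rw [← sub_eq_zero]
  change D n = 0
  rw [← norm_le_zero_iff]
  refine le_of_forall_pos_le_add fun ε hε => ?_
  have hc : 0 < 2 * ‖K‖ + t + 1 := by positivity
  obtain ⟨g, -, hg1, hg2, hg3⟩ := hn.exists_hasCompactSupport_integral_sub_le
    (show 0 < ε / (2 * ‖K‖ + t + 1) by positivity)
  have h1 := hb _ (hn.sub hg3)
  have h2 : D g = 0 := sub_eq_zero.2 (hS.integral_of_continuous hg2 t)
  have h3 : D (n - g) = D n := by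
    have := hsub n g hn hg3
    rw [h2, sub_zero] at this
    exact this
  rw [h3] at h1
  rw [le_div_iff₀ hc] at hg1
  have h4 : 0 ≤ ∫ s, ‖n s - g s‖ := integral_nonneg fun s => norm_nonneg _
  simp only [Pi.sub_apply] at h1
  nlinarith

/-- Duhamel's formula: `U(t) = S(t) (U₀ + ∫₀ᵗ S(-s) N(s) ds)` solves `K U' = U + K N` in
integrated form. -/
theorem duhamel (hS : IsGroupOfInverse K S) {N : ℝ → E} {t : ℝ} (ht : 0 ≤ t)
    (hN : IntervalIntegrable N volume 0 t) (U₀ : E) :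
    K (S t (U₀ + ∫ s in (0 : ℝ)..t, S (-s) (N s))) = K U₀
      + (∫ τ in (0 : ℝ)..t, S τ (U₀ + ∫ s in (0 : ℝ)..τ, S (-s) (N s)))
      + K (∫ s in (0 : ℝ)..t, N s) := by
  -- With S(-s) absorbed into n one has N = S n on (0, t]. The cutoff makes n integrable on the
  -- whole line.
  set n : ℝ → E := (Ioc 0 t).indicator fun s => S (-s) (N s) with hn
  have hni : Integrable n := by
    rw [hn, integrable_indicator_iff measurableSet_Ioc,
      ← intervalIntegrable_iff_integrableOn_Ioc_of_le ht]
    exact hS.intervalIntegrable_apply continuous_neg hN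
  have h1 : ∀ τ ∈ Icc 0 t, ∫ s in (0 : ℝ)..τ, S (-s) (N s) = ∫ s in (0 : ℝ)..τ, n s := by
    intro τ hτ
    refine intervalIntegral.integral_congr_ae (Eventually.of_forall fun s hs => ?_)
    rw [uIoc_of_le hτ.1] at hs
    rw [hn, indicator_of_mem (show s ∈ Ioc 0 t from ⟨hs.1, hs.2.trans hτ.2⟩)]
  have h2 : ∫ s in (0 : ℝ)..t, N s = ∫ s in (0 : ℝ)..t, S s (n s) := by
    refine intervalIntegral.integral_congr_ae (Eventually.of_forall fun s hs => ?_)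
    rw [uIoc_of_le ht] at hs
    rw [hn, indicator_of_mem hs, hS.neg_apply_apply]
  have h3 : ∫ τ in (0 : ℝ)..t, S τ (U₀ + ∫ s in (0 : ℝ)..τ, S (-s) (N s))
      = ∫ τ in (0 : ℝ)..t, (S τ U₀ + S τ (∫ s in (0 : ℝ)..τ, n s)) := by
    refine intervalIntegral.integral_congr fun τ hτ => ?_
    rw [uIcc_of_le ht] at hτ
    simp only [h1 τ hτ, map_add]
  have hPc : Continuous fun τ => ∫ s in (0 : ℝ)..τ, n s :=
    intervalIntegral.continuous_primitive (fun _ _ => hni.intervalIntegrable) 0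
  rw [h3, h1 t ⟨ht, le_rfl⟩, h2, map_add, map_add, hS.integral_of_integrable hni ht,
    intervalIntegral.integral_add ((hS.continuous U₀).intervalIntegrable _ _)
      ((hS.continuous_apply (g := fun t => t) continuous_id hPc).intervalIntegrable _ _),
    ← hS.integral]
  abel

end IsGroupOfInverse

end Duhamel

/-! ### Neumann series in an exponentially weighted norm. -/

section Volterra

variable {E : Type*} [NormedAddCommGroup E]

/-- A linear operator on `C([0,T]; E)` that halves the norm weighted by `e^{-λt}`
has `1` in its resolvent set. -/
theorem exists_fixed_of_weighted_contraction [NormedSpace ℝ E] [CompleteSpace E] {T l : ℝ}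
    (hl : 0 ≤ l)
    (A : C(Icc (0 : ℝ) T, E) →ₗ[ℝ] C(Icc (0 : ℝ) T, E))
    (hA : ∀ U : C(Icc (0 : ℝ) T, E), ∀ a, 0 ≤ a → (∀ t, ‖U t‖ ≤ a * Real.exp (l * t)) →
      ∀ t, ‖A U t‖ ≤ a / 2 * Real.exp (l * t)) (W : C(Icc (0 : ℝ) T, E)) :
    ∃ U : C(Icc (0 : ℝ) T, E), U = W + A U ∧ ‖U‖ ≤ 2 * Real.exp (l * T) * ‖W‖ := by
  have hone : ∀ t : Icc (0 : ℝ) T, 1 ≤ Real.exp (l * t) := fun t =>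
    Real.one_le_exp (mul_nonneg hl t.2.1)
  have hle : ∀ t : Icc (0 : ℝ) T, Real.exp (l * t) ≤ Real.exp (l * T) := fun t =>
    Real.exp_le_exp.2 (mul_le_mul_of_nonneg_left t.2.2 hl)
  have hbase : ∀ U : C(Icc (0 : ℝ) T, E), ∀ t, ‖U t‖ ≤ ‖U‖ * Real.exp (l * t) := fun U t =>
    (U.norm_coe_le_norm t).trans (le_mul_of_one_le_right (norm_nonneg _) (hone t))
  have hAb : ∀ U, ‖A U‖ ≤ Real.exp (l * T) * ‖U‖ := fun U => by
    refine (ContinuousMap.norm_le _ (by positivity)).2 fun t => ?_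
    refine (hA U _ (norm_nonneg U) (hbase U) t).trans ?_
    nlinarith [hle t, norm_nonneg U, Real.exp_pos (l * t),
      mul_le_mul_of_nonneg_left (hle t) (norm_nonneg U)]
  set B := A.mkContinuous _ hAb with hB
  have hBA : ∀ U, B U = A U := fun U => rfl
  -- The solution is ∑ BⁿW. Each application of B halves the weighted bound, so the unweighted norms
  -- are at most e^{lT}‖W‖2⁻ⁿ, whose sum is the stated constant.
  set p : ℕ → C(Icc (0 : ℝ) T, E) := fun n => (B ^ n) W with hp
  have hp0 : p 0 = W := by simp [hp]
  have hps : ∀ n, p (n + 1) = B (p n) := fun n => by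
    simp only [hp, pow_succ', mul_apply_eq_comp]
  have hpw : ∀ n t, ‖p n t‖ ≤ ‖W‖ * (1 / 2) ^ n * Real.exp (l * t) := by
    intro n
    induction n with
    | zero => simpa [hp0] using hbase W
    | succ n ih =>
      intro t
      rw [hps, hBA, pow_succ]
      refine (hA _ _ (by positivity) ih t).trans (le_of_eq (by ring))
  have hpn : ∀ n, ‖p n‖ ≤ Real.exp (l * T) * ‖W‖ * (1 / 2) ^ n := by
    intro n
    refine (ContinuousMap.norm_le _ (by positivity)).2 fun t => (hpw n t).trans ?_
    have := mul_le_mul_of_nonneg_left (hle t) (show 0 ≤ ‖W‖ * (1 / 2 : ℝ) ^ n by positivity)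
    linarith
  have hsum := hasSum_geometric_two.mul_left (Real.exp (l * T) * ‖W‖)
  have hps_sum : Summable p := Summable.of_norm_bounded hsum.summable hpn
  refine ⟨∑' n, p n, ?_, (tsum_of_norm_bounded hsum hpn).trans (le_of_eq (by ring))⟩
  rw [← hBA, B.map_tsum hps_sum, hps_sum.tsum_eq_zero_add, hp0]
  simp only [hps]

end Volterra

/-! ### The zero-order term with memory. -/

section Memory

variable {E F : Type*} [NormedAddCommGroup E] [NormedSpace ℝ E] [NormedAddCommGroup F]
  [NormedSpace ℝ F]

/-- The operator `U ↦ L U(s) - ∫₀ˢ M(s,r) L U(r) dr`. -/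
noncomputable def memoryOp (L : E →L[ℝ] F) (M : ℝ → ℝ → ℝ) (U : ℝ → E) (s : ℝ) : F :=
  L (U s) - ∫ r in (0 : ℝ)..s, M s r • L (U r)

variable {L : E →L[ℝ] F} {M : ℝ → ℝ → ℝ}

theorem continuous_memoryOp (hM : Continuous fun p : ℝ × ℝ => M p.1 p.2) {U : ℝ → E}
    (hU : Continuous U) : Continuous (memoryOp L M U) := by
  refine (L.continuous.comp hU).sub ?_
  refine intervalIntegral.continuous_parametric_intervalIntegral_of_continuous
    (f := fun s r => M s r • L (U r)) ?_ continuous_id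
  exact hM.smul (L.continuous.comp (hU.comp continuous_snd))

theorem intervalIntegrable_memoryOp_kernel (hM : Continuous fun p : ℝ × ℝ => M p.1 p.2)
    {U : ℝ → E} (hU : Continuous U) (s a b : ℝ) :
    IntervalIntegrable (fun r => M s r • L (U r)) volume a b :=
  ((hM.comp (Continuous.prodMk_right s)).smul (L.continuous.comp hU)).intervalIntegrable _ _

theorem memoryOp_add (hM : Continuous fun p : ℝ × ℝ => M p.1 p.2) {U V : ℝ → E}
    (hU : Continuous U) (hV : Continuous V) (s : ℝ) :
    memoryOp L M (fun r => U r + V r) s = memoryOp L M U s + memoryOp L M V s := by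
  simp only [memoryOp, map_add, smul_add]
  rw [intervalIntegral.integral_add (intervalIntegrable_memoryOp_kernel hM hU _ _ _)
    (intervalIntegrable_memoryOp_kernel hM hV _ _ _)]
  abel

theorem memoryOp_smul (c : ℝ) (U : ℝ → E) (s : ℝ) :
    memoryOp L M (fun r => c • U r) s = c • memoryOp L M U s := by
  simp only [memoryOp, map_smul, smul_comm _ c, intervalIntegral.integral_smul, smul_sub]

/-- Since e^{lr} ≤ e^{ls} for r ≤ s, dependence on the past preserves exponential bounds, with a
factor independent of l. Choosing l large later is therefore effective. -/
theorem norm_memoryOp_le {m T a l : ℝ} (hl : 0 ≤ l) (ha : 0 ≤ a) (hm : 0 ≤ m)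
    (hM : ∀ s ∈ Icc 0 T, ∀ r ∈ Icc 0 T, |M s r| ≤ m) {U : ℝ → E} {s : ℝ} (hs : s ∈ Icc 0 T)
    (hU : ∀ r ∈ Icc 0 s, ‖L (U r)‖ ≤ a * Real.exp (l * r)) :
    ‖memoryOp L M U s‖ ≤ (1 + m * T) * a * Real.exp (l * s) := by
  have h1 : ‖∫ r in (0 : ℝ)..s, M s r • L (U r)‖ ≤ (m * (a * Real.exp (l * s))) * |s - 0| := by
    refine intervalIntegral.norm_integral_le_of_norm_le_const fun r hr => ?_
    rw [uIoc_of_le hs.1] at hr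
    rw [norm_smul]
    refine mul_le_mul (hM s hs r ⟨hr.1.le, hr.2.trans hs.2⟩)
      ((hU r ⟨hr.1.le, hr.2⟩).trans ?_) (norm_nonneg _) hm
    gcongr
    exact hr.2
  rw [sub_zero, abs_of_nonneg hs.1] at h1
  have h2 : (m * (a * Real.exp (l * s))) * s ≤ (m * (a * Real.exp (l * s))) * T := by
    gcongr
    exact hs.2
  calc _ ≤ _ := norm_sub_le _ _
    _ ≤ _ := add_le_add (hU s ⟨hs.1, le_rfl⟩) (h1.trans h2)
    _ = _ := by ring

end Memory

/-! ### Mild solutions: existence by Duhamel, uniqueness by a weak energy estimate. -/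

section Mild

theorem integral_exp_mul_le {l t : ℝ} (hl : 0 < l) :
    ∫ s in (0 : ℝ)..t, Real.exp (l * s) ≤ Real.exp (l * t) / l := by
  have h : ∀ s, HasDerivAt (fun s => Real.exp (l * s) / l) (Real.exp (l * s)) s := fun s => by
    have := (((hasDerivAt_id s).const_mul l).exp).div_const l
    refine this.congr_deriv ?_
    simp [hl.ne']
  rw [intervalIntegral.integral_eq_sub_of_hasDerivAt (fun s _ => h s)
    (Continuous.intervalIntegrable (by fun_prop) _ _)]
  have := Real.exp_pos (l * 0)
  have : 0 ≤ Real.exp (l * 0) / l := by positivity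
  linarith

variable {E : Type*} [NormedAddCommGroup E] [InnerProductSpace ℝ E] [CompleteSpace E]
  {K : E →L[ℝ] E} {S : ℝ → E →L[ℝ] E}

theorem IsGroupOfInverse.exists_mild (hS : IsGroupOfInverse K S) (L : E →L[ℝ] E) {M : ℝ → ℝ → ℝ}
    (hM : Continuous fun p : ℝ × ℝ => M p.1 p.2) {T : ℝ} (hT : 0 ≤ T) :
    ∃ C : ℝ, 0 < C ∧ ∀ (U₀ : E) (f : ℝ → E), Integrable f → ∃ U : ℝ → E, Continuous U ∧ U 0 = U₀ ∧
      ∀ t ∈ Icc 0 T, ‖U t‖ ≤ C * (‖U₀‖ + ∫ s, ‖f s‖) ∧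
        K (U t) = K U₀ + (∫ s in (0 : ℝ)..t, U s)
          + K (∫ s in (0 : ℝ)..t, (memoryOp L M U s + f s)) := by
  obtain ⟨m, hm⟩ := (isCompact_Icc.prod isCompact_Icc).exists_bound_of_continuousOn
    (s := Icc (0 : ℝ) T ×ˢ Icc (0 : ℝ) T) hM.continuousOn
  have hm0 : 0 ≤ m := (norm_nonneg _).trans (hm (0, 0) ⟨⟨le_rfl, hT⟩, ⟨le_rfl, hT⟩⟩)
  have hm' : ∀ s ∈ Icc 0 T, ∀ r ∈ Icc 0 T, |M s r| ≤ m := fun s hs r hr => hm (s, r) ⟨hs, hr⟩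
  set c : ℝ := (1 + m * T) * ‖L‖ with hc
  have hc0 : 0 ≤ c := by positivity
  -- Integrating c e^{ls} over [0, t] costs at most (c/l) e^{lt}, and this l gives c/l ≤ 1/2.
  set l : ℝ := 2 * c + 1 with hl
  have hl0 : 0 < l := by positivity
  -- Curves are frozen at their endpoint values outside [0, T], so they stay continuous on the whole
  -- line.
  set ext : C(Icc (0 : ℝ) T, E) → ℝ → E := fun U s => U (projIcc 0 T hT s) with hext
  have hextc : ∀ U, Continuous (ext U) := fun U => U.continuous.comp continuous_projIcc
  have hextm : ∀ U, ∀ t (ht : t ∈ Icc 0 T), ext U t = U ⟨t, ht⟩ := fun U t ht => by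
    simp only [hext, projIcc_of_mem hT ht]
  have hmc : ∀ U, Continuous (memoryOp L M (ext U)) := fun U => continuous_memoryOp hM (hextc U)
  have hkc : ∀ U, Continuous fun s => S (-s) (memoryOp L M (ext U) s) := fun U =>
    hS.continuous_apply continuous_neg (hmc U)
  have hprim : ∀ n : ℝ → E, (∀ a b, IntervalIntegrable n volume a b) →
      Continuous fun t => S t (∫ s in (0 : ℝ)..t, n s) := fun n hn =>
    hS.continuous_apply continuous_id (intervalIntegral.continuous_primitive hn 0)
  let A : C(Icc (0 : ℝ) T, E) →ₗ[ℝ] C(Icc (0 : ℝ) T, E) :=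
    { toFun := fun U => ⟨fun t => S t (∫ s in (0 : ℝ)..t, S (-s) (memoryOp L M (ext U) s)),
        (hprim _ fun a b => (hkc U).intervalIntegrable a b).comp continuous_subtype_val⟩
      map_add' := fun U V => by
        ext t
        have h1 : ext (U + V) = fun s => ext U s + ext V s := rfl
        simp only [ContinuousMap.coe_mk, ContinuousMap.add_apply, h1,
          memoryOp_add hM (hextc U) (hextc V), map_add]
        rw [intervalIntegral.integral_add ((hkc U).intervalIntegrable _ _)
          ((hkc V).intervalIntegrable _ _), map_add]
      map_smul' := fun a U => by
        ext t
        have h1 : ext (a • U) = fun s => a • ext U s := rfl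
        simp only [ContinuousMap.coe_mk, ContinuousMap.smul_apply, h1, memoryOp_smul, map_smul,
          intervalIntegral.integral_smul, RingHom.id_apply] }
  have hAap : ∀ U t, A U t = S t (∫ s in (0 : ℝ)..t, S (-s) (memoryOp L M (ext U) s)) :=
    fun U t => rfl
  have hAb : ∀ U : C(Icc (0 : ℝ) T, E), ∀ a, 0 ≤ a → (∀ t, ‖U t‖ ≤ a * Real.exp (l * t)) →
      ∀ t, ‖A U t‖ ≤ a / 2 * Real.exp (l * t) := by
    intro U a ha hU t
    rw [hAap, hS.norm_apply]
    have h1 : ∀ s ∈ Icc (0 : ℝ) t,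
        ‖S (-s) (memoryOp L M (ext U) s)‖ ≤ (c * a) * Real.exp (l * s) := by
      intro s hs
      rw [hS.norm_apply]
      refine (norm_memoryOp_le hl0.le (a := ‖L‖ * a) (by positivity) hm0 hm'
        ⟨hs.1, hs.2.trans t.2.2⟩ fun r hr => ?_).trans (le_of_eq (by rw [hc]; ring))
      have hr' : r ∈ Icc 0 T := ⟨hr.1, hr.2.trans (hs.2.trans t.2.2)⟩
      refine (L.le_opNorm _).trans ?_
      rw [mul_assoc, hextm U r hr']
      gcongr
      exact hU ⟨r, hr'⟩
    refine (intervalIntegral.norm_integral_le_of_norm_le t.2.1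
      (g := fun s => (c * a) * Real.exp (l * s))
      (Eventually.of_forall fun s hs => h1 s ⟨hs.1.le, hs.2⟩)
      (Continuous.intervalIntegrable (by fun_prop) _ _)).trans ?_
    rw [intervalIntegral.integral_const_mul]
    refine (mul_le_mul_of_nonneg_left (integral_exp_mul_le hl0) (by positivity)).trans ?_
    rw [mul_div_assoc', div_le_iff₀ hl0, hl]
    have := Real.exp_pos (l * t)
    nlinarith [mul_nonneg ha this.le]
  refine ⟨2 * Real.exp (l * T), by positivity, fun U₀ f hf => ?_⟩
  have hSf : Integrable fun s => S (-s) (f s) := hS.integrable_apply continuous_neg hf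
  set W : C(Icc (0 : ℝ) T, E) := ⟨fun t => S t U₀ + S t (∫ s in (0 : ℝ)..t, S (-s) (f s)),
    ((hS.continuous U₀).add (hprim _ fun a b => hSf.intervalIntegrable)).comp
      continuous_subtype_val⟩ with hW
  have hWn : ‖W‖ ≤ ‖U₀‖ + ∫ s, ‖f s‖ := by
    refine (ContinuousMap.norm_le _ (by positivity)).2 fun t => (norm_add_le _ _).trans ?_
    rw [hS.norm_apply, hS.norm_apply]
    refine add_le_add le_rfl ((intervalIntegral.norm_integral_le_integral_norm t.2.1).trans ?_)
    simp only [hS.norm_apply]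
    rw [intervalIntegral.integral_of_le t.2.1]
    exact setIntegral_le_integral hf.norm (Eventually.of_forall fun s => norm_nonneg _)
  obtain ⟨U, hU, hUn⟩ := exists_fixed_of_weighted_contraction hl0.le A hAb W
  have hUt : ∀ t ∈ Icc 0 T, ext U t
      = S t (U₀ + ∫ s in (0 : ℝ)..t, S (-s) (memoryOp L M (ext U) s + f s)) := by
    intro t ht
    rw [hextm U t ht, hU, ContinuousMap.add_apply, hAap, ← hU]
    simp only [map_add]
    rw [intervalIntegral.integral_add ((hkc U).intervalIntegrable _ _) hSf.intervalIntegrable,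
      map_add]
    simp only [hW, ContinuousMap.coe_mk]
    abel
  refine ⟨ext U, hextc U, ?_, fun t ht => ⟨?_, ?_⟩⟩
  · rw [hUt 0 ⟨le_rfl, hT⟩]
    simp [hS.zero]
  · calc ‖ext U t‖ ≤ ‖U‖ := U.norm_coe_le_norm _
      _ ≤ _ := hUn
      _ ≤ _ := by gcongr
  · have h := hS.duhamel ht.1 (N := fun s => memoryOp L M (ext U) s + f s)
      (((hmc U).intervalIntegrable _ _).add hf.intervalIntegrable) U₀
    rw [← hUt t ht] at h
    rw [h]
    congr 2
    refine intervalIntegral.integral_congr fun s hs => ?_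
    rw [uIcc_of_le ht.1] at hs
    exact (hUt s ⟨hs.1, hs.2.trans ht.2⟩).symm

/-- Uniqueness for `K D' = D + n` with `D(0) = 0` when `n` is controlled by the past of `K D`. -/
theorem IsSkew.eq_zero_of_integral_eq (hK : IsSkew K) {T c : ℝ} (hc : 0 ≤ c)
    {D n : ℝ → E} (hD : Continuous D) (hn : Continuous n)
    (heq : ∀ t ∈ Icc 0 T, K (D t) = (∫ s in (0 : ℝ)..t, D s) + ∫ s in (0 : ℝ)..t, n s)
    (hbound : ∀ l a, 0 ≤ l → 0 ≤ a → ∀ t ∈ Icc 0 T,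
      (∀ s ∈ Icc 0 t, ‖K (D s)‖ ≤ a * Real.exp (l * s)) → ‖n t‖ ≤ c * a * Real.exp (l * t)) :
    ∀ t ∈ Icc 0 T, K (D t) = 0 := by
  intro t₁ ht₁
  have hT : 0 ≤ T := ht₁.1.trans ht₁.2
  set l : ℝ := c + 1 with hl
  have hl0 : 0 < l := by positivity
  -- Gronwall through the weighted maximum a of ‖K D‖: the energy estimate at the point where a is
  -- attained yields a² l ≤ c a², and l = c + 1 forces a = 0.
  obtain ⟨t₀, ht₀, hmax⟩ := isCompact_Icc.exists_isMaxOn (s := Icc (0 : ℝ) T)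
    (f := fun t => ‖K (D t)‖ * Real.exp (-(l * t))) ⟨0, le_rfl, hT⟩ (by fun_prop)
  set a : ℝ := ‖K (D t₀)‖ * Real.exp (-(l * t₀)) with ha
  have ha0 : 0 ≤ a := by positivity
  have hle : ∀ t ∈ Icc 0 T, ‖K (D t)‖ ≤ a * Real.exp (l * t) := by
    intro t ht
    have h1 : ‖K (D t)‖ * Real.exp (-(l * t)) ≤ a := hmax ht
    calc ‖K (D t)‖ = ‖K (D t)‖ * Real.exp (-(l * t)) * Real.exp (l * t) := by
          rw [mul_assoc, ← Real.exp_add]; simp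
      _ ≤ _ := by gcongr
  -- q is a C¹ function on the line that equals K D on [0, T]. There the derivative of ‖q‖² is 2⟨KD,
  -- D + n⟩ = 2⟨KD, n⟩ by skewness.
  set q : ℝ → E := fun t => (∫ s in (0 : ℝ)..t, D s) + ∫ s in (0 : ℝ)..t, n s with hq
  have hqd : ∀ t, HasDerivAt q (D t + n t) t := fun t =>
    (hD.integral_hasStrictDerivAt 0 t).hasDerivAt.add (hn.integral_hasStrictDerivAt 0 t).hasDerivAt
  have hqc : Continuous q := continuous_iff_continuousAt.2 fun t => (hqd t).continuousAt
  have hint := intervalIntegral.integral_eq_sub_of_hasDerivAt (a := 0) (b := t₀)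
    (fun s _ => (hqd s).norm_sq) (Continuous.intervalIntegrable (by fun_prop) _ _)
  have hq0 : q 0 = 0 := by simp [hq]
  rw [hq0, norm_zero] at hint
  have hb : ∫ s in (0 : ℝ)..t₀, 2 * inner ℝ (q s) (D s + n s)
      ≤ ∫ s in (0 : ℝ)..t₀, (2 * c * a ^ 2) * Real.exp ((2 * l) * s) := by
    refine intervalIntegral.integral_mono_on ht₀.1 (Continuous.intervalIntegrable (by fun_prop) _ _)
      (Continuous.intervalIntegrable (by fun_prop) _ _) fun s hs => ?_
    have hs' : s ∈ Icc 0 T := ⟨hs.1, hs.2.trans ht₀.2⟩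
    have h1 : q s = K (D s) := (heq s hs').symm
    rw [h1, inner_add_right, hK.inner_self, zero_add]
    have h2 := real_inner_le_norm (K (D s)) (n s)
    have h3 := hbound l a hl0.le ha0 s hs' fun r hr => hle r ⟨hr.1, hr.2.trans hs'.2⟩
    have h4 := mul_le_mul (hle s hs') h3 (norm_nonneg _) (by positivity)
    have h5 : Real.exp (2 * l * s) = Real.exp (l * s) * Real.exp (l * s) := by
      rw [← Real.exp_add]; congr 1; ring
    rw [h5]
    linarith
  rw [hint, intervalIntegral.integral_const_mul] at hb
  have h6 : (2 * c * a ^ 2) * ∫ s in (0 : ℝ)..t₀, Real.exp ((2 * l) * s)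
      ≤ (2 * c * a ^ 2) * (Real.exp (2 * l * t₀) / (2 * l)) :=
    mul_le_mul_of_nonneg_left (integral_exp_mul_le (by positivity)) (by positivity)
  have h7 : ‖q t₀‖ = a * Real.exp (l * t₀) := by
    rw [ha, mul_assoc, ← Real.exp_add]
    simp [hq, heq t₀ ht₀]
  have h8 : Real.exp (2 * l * t₀) = Real.exp (l * t₀) ^ 2 := by
    rw [← Real.exp_nat_mul]; congr 1; push_cast; ring
  have h9 : a ^ 2 * Real.exp (l * t₀) ^ 2 ≤ (2 * c * a ^ 2) * (Real.exp (l * t₀) ^ 2 / (2 * l)) := by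
    rw [h8] at h6
    rw [h7] at hb
    linarith
  have h10 : a ^ 2 * l ≤ c * a ^ 2 := by
    have hpos : 0 < Real.exp (l * t₀) ^ 2 := by positivity
    rw [mul_div_assoc', le_div_iff₀ (by positivity)] at h9
    nlinarith
  have ha2 : a = 0 := by
    rw [hl] at h10
    have : a ^ 2 ≤ 0 := by linarith
    exact pow_eq_zero_iff two_ne_zero |>.1 (le_antisymm this (sq_nonneg a))
  have := hle t₁ ht₁
  rw [ha2, zero_mul] at this
  exact norm_le_zero_iff.1 this

end Mild

/-! ### The wave equation for an abstract injection `J` with dense range. -/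

section AbstractWave

theorem map_memoryOp {E F G : Type*} [NormedAddCommGroup E] [NormedSpace ℝ E]
    [NormedAddCommGroup F] [NormedSpace ℝ F] [CompleteSpace F] [NormedAddCommGroup G]
    [NormedSpace ℝ G] [CompleteSpace G] (A : F →L[ℝ] G) (L : E →L[ℝ] F) {M : ℝ → ℝ → ℝ}
    (hM : Continuous fun p : ℝ × ℝ => M p.1 p.2) {U : ℝ → E} (hU : Continuous U) (s : ℝ) :
    A (memoryOp L M U s) = memoryOp (A ∘L L) M U s := by
  simp only [memoryOp, map_sub, ContinuousLinearMap.comp_apply]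
  rw [← A.intervalIntegral_comp_comm (intervalIntegrable_memoryOp_kernel hM hU _ _ _)]
  simp only [map_smul]

variable {V H : Type*} [NormedAddCommGroup V] [InnerProductSpace ℝ V]
  [NormedAddCommGroup H] [InnerProductSpace ℝ H]

/-- The operator `(y, w) ↦ (0, J y)` on pairs. -/
noncomputable def embedSnd (J : V →L[ℝ] H) : WithLp 2 (V × H) →L[ℝ] WithLp 2 (V × H) :=
  (WithLp.prodContinuousLinearEquiv 2 ℝ V H).symm.toContinuousLinearMap ∘L
    ((0 : WithLp 2 (V × H) →L[ℝ] V).prod (J ∘L WithLp.fstL 2 ℝ V H))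

variable [CompleteSpace V] [CompleteSpace H]

/-- The inverse `(a, b) ↦ (-J† b, J a)` of the generator of the wave equation
`⟪y'', J v⟫ + ⟪y, v⟫ = 0`. -/
noncomputable def waveInverse (J : V →L[ℝ] H) : WithLp 2 (V × H) →L[ℝ] WithLp 2 (V × H) :=
  (WithLp.prodContinuousLinearEquiv 2 ℝ V H).symm.toContinuousLinearMap ∘L
    ((-(ContinuousLinearMap.adjoint J ∘L WithLp.sndL 2 ℝ V H)).prod (J ∘L WithLp.fstL 2 ℝ V H))

theorem waveInverse_apply (J : V →L[ℝ] H) (x : WithLp 2 (V × H)) :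
    waveInverse J x = WithLp.toLp 2 (-(ContinuousLinearMap.adjoint J x.snd), J x.fst) := rfl

theorem isSkew_waveInverse (J : V →L[ℝ] H) : IsSkew (waveInverse J) := by
  intro x y
  change inner ℝ (-(ContinuousLinearMap.adjoint J x.snd)) y.fst + inner ℝ (J x.fst) y.snd
    = -(inner ℝ x.fst (-(ContinuousLinearMap.adjoint J y.snd)) + inner ℝ x.snd (J y.fst))
  rw [inner_neg_left, inner_neg_right, ContinuousLinearMap.adjoint_inner_left,
    ContinuousLinearMap.adjoint_inner_right]
  ring

/-- If x is orthogonal to the range of K, then 0 = ⟨K(Kx), x⟩ = -‖Kx‖², so x = 0 by injectivity. -/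
theorem IsSkew.denseRange {E : Type*} [NormedAddCommGroup E] [InnerProductSpace ℝ E]
    [CompleteSpace E] {K : E →L[ℝ] E} (hK : IsSkew K) (hinj : Function.Injective K) :
    DenseRange K := by
  have h : (LinearMap.range (K : E →ₗ[ℝ] E)).topologicalClosure = ⊤ := by
    rw [Submodule.topologicalClosure_eq_top_iff, Submodule.eq_bot_iff]
    intro x hx
    have h1 : inner ℝ (K (K x)) x = 0 := hx _ ⟨K x, rfl⟩
    rw [hK, neg_eq_zero, inner_self_eq_zero] at h1
    exact hinj (by rw [h1, map_zero])
  rw [← Submodule.dense_iff_topologicalClosure_eq_top] at h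
  exact h

theorem injective_waveInverse {J : V →L[ℝ] H} (hinj : Function.Injective J)
    (hdense : DenseRange J) : Function.Injective (waveInverse J) := by
  rw [injective_iff_map_eq_zero]
  intro x hx
  rw [waveInverse_apply] at hx
  have h1 : ContinuousLinearMap.adjoint J x.snd = 0 := by
    simpa using congrArg WithLp.fst hx
  have h2 : J x.fst = 0 := congrArg WithLp.snd hx
  have h3 : x.fst = 0 := hinj (by rw [h2, map_zero])
  have h4 : x.snd = 0 := by
    refine hdense.eq_zero_of_inner_left ℝ fun v => ?_
    rw [← ContinuousLinearMap.adjoint_inner_left, h1, inner_zero_left]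
  exact (WithLp.equiv 2 (V × H)).injective (Prod.ext h3 h4)

variable (J : V →L[ℝ] H) {M : ℝ → ℝ → ℝ}

/-- The mild equation is read off by components. The perturbation and force have the form (0, ·),
which K sends to (-J†·, 0). The second component is thus J y = J y₀ + ∫ w, and the first, paired
with v, is the weak equation. -/
theorem exists_wave (hinj : Function.Injective J) (hdense : DenseRange J)
    (hM : Continuous fun p : ℝ × ℝ => M p.1 p.2) {T : ℝ} (hT : 0 ≤ T) :
    ∃ C : ℝ, 0 < C ∧ ∀ (y₀ : V) (w₀ : H) (f : ℝ → H), Integrable f →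
      ∃ (y : ℝ → V) (w : ℝ → H), Continuous y ∧ Continuous w ∧ y 0 = y₀ ∧ w 0 = w₀ ∧
      ∀ t ∈ Icc 0 T,
        ‖y t‖ ≤ C * (Real.sqrt (‖y₀‖ ^ 2 + ‖w₀‖ ^ 2) + ∫ s, ‖f s‖) ∧
        ‖w t‖ ≤ C * (Real.sqrt (‖y₀‖ ^ 2 + ‖w₀‖ ^ 2) + ∫ s, ‖f s‖) ∧
        J (y t) = J y₀ + ∫ s in (0 : ℝ)..t, w s ∧
        ∀ v, inner ℝ (w t) (J v) - inner ℝ w₀ (J v)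
          + ∫ s in (0 : ℝ)..t, (inner ℝ (y s) v - inner ℝ (memoryOp J M y s) (J v))
          = ∫ s in (0 : ℝ)..t, inner ℝ (f s) (J v) := by
  have hskew := isSkew_waveInverse J
  obtain ⟨S, hS⟩ := hskew.exists_group (hskew.denseRange (injective_waveInverse hinj hdense))
  obtain ⟨C, hC, h⟩ := hS.exists_mild (embedSnd J) hM hT
  refine ⟨C, hC, fun y₀ w₀ f hf => ?_⟩
  set inr : H →L[ℝ] WithLp 2 (V × H) :=
    (WithLp.prodContinuousLinearEquiv 2 ℝ V H).symm.toContinuousLinearMap ∘L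
      ContinuousLinearMap.inr ℝ V H
  have hinr : ∀ b, inr b = WithLp.toLp 2 (0, b) := fun b => rfl
  have hinrn : ∀ b, ‖inr b‖ = ‖b‖ := fun b => by
    rw [hinr, WithLp.prod_norm_eq_of_L2]
    simp
  set fstL := WithLp.fstL 2 ℝ V H
  set sndL := WithLp.sndL 2 ℝ V H
  have hf' : Integrable fun s => inr (f s) := inr.integrable_comp hf
  obtain ⟨U, hUc, hU0, hU⟩ := h (WithLp.toLp 2 (y₀, w₀)) (fun s => inr (f s)) hf'
  have hyc : Continuous fun s => (U s).fst := fstL.continuous.comp hUc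
  have hwc : Continuous fun s => (U s).snd := sndL.continuous.comp hUc
  refine ⟨fun s => (U s).fst, fun s => (U s).snd, hyc, hwc,
    congrArg WithLp.fst hU0, congrArg WithLp.snd hU0,
    fun t ht => ?_⟩
  obtain ⟨hb, he⟩ := hU t ht
  have hn0 : ‖(WithLp.toLp 2 (y₀, w₀) : WithLp 2 (V × H))‖ = Real.sqrt (‖y₀‖ ^ 2 + ‖w₀‖ ^ 2) :=
    WithLp.prod_norm_eq_of_L2 _
  simp only [hinrn, hn0] at hb
  have hsq := WithLp.prod_norm_sq_eq_of_L2 (U t)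
  have hUi : IntervalIntegrable U volume 0 t := hUc.intervalIntegrable _ _
  have hmc : Continuous (memoryOp (embedSnd J) M U) := continuous_memoryOp hM hUc
  have hNi : IntervalIntegrable (fun s => memoryOp (embedSnd J) M U s + inr (f s)) volume 0 t :=
    (hmc.intervalIntegrable _ _).add hf'.intervalIntegrable
  have hms : ∀ s, (memoryOp (embedSnd J) M U s).snd = memoryOp J M (fun s => (U s).fst) s :=
    fun s => map_memoryOp sndL (embedSnd J) hM hUc s
  have hmc2 : Continuous (memoryOp J M fun s => (U s).fst) := continuous_memoryOp hM hyc
  refine ⟨le_trans ?_ hb, le_trans ?_ hb, ?_, fun v => ?_⟩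
  · exact le_of_sq_le_sq (by nlinarith [sq_nonneg ‖(U t).snd‖]) (norm_nonneg _)
  · exact le_of_sq_le_sq (by nlinarith [sq_nonneg ‖(U t).fst‖]) (norm_nonneg _)
  · have h1 := congrArg sndL he
    have h0 : sndL (waveInverse J (∫ s in (0 : ℝ)..t, (memoryOp (embedSnd J) M U s + inr (f s))))
        = ∫ s in (0 : ℝ)..t, (sndL ∘L waveInverse J) (memoryOp (embedSnd J) M U s + inr (f s)) :=
      ((sndL ∘L waveInverse J).intervalIntegral_comp_comm hNi).symm
    rw [map_add, map_add, ← sndL.intervalIntegral_comp_comm hUi, h0] at h1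
    have h2 : ∀ s, (sndL ∘L waveInverse J) (memoryOp (embedSnd J) M U s + inr (f s)) = 0 := by
      intro s
      have h3 : (memoryOp (embedSnd J) M U s).fst = 0 := by
        have h4 := map_memoryOp fstL (embedSnd J) hM hUc s
        have h5 : fstL ∘L embedSnd J = 0 := by
          ext x
          rfl
        rw [h5] at h4
        exact h4.trans (by simp [memoryOp])
      change J ((memoryOp (embedSnd J) M U s).fst + (0 : V)) = 0
      rw [h3, add_zero, map_zero]
    simp only [h2, intervalIntegral.integral_zero, add_zero] at h1
    exact h1
  · have h1 := congrArg fstL he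
    have h0 : fstL (waveInverse J (∫ s in (0 : ℝ)..t, (memoryOp (embedSnd J) M U s + inr (f s))))
        = ∫ s in (0 : ℝ)..t, (fstL ∘L waveInverse J) (memoryOp (embedSnd J) M U s + inr (f s)) :=
      ((fstL ∘L waveInverse J).intervalIntegral_comp_comm hNi).symm
    rw [map_add, map_add, ← fstL.intervalIntegral_comp_comm hUi, h0] at h1
    have h2 : ∀ s, (fstL ∘L waveInverse J) (memoryOp (embedSnd J) M U s + inr (f s))
        = -(ContinuousLinearMap.adjoint J (memoryOp J M (fun s => (U s).fst) s + f s)) := by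
      intro s
      rw [← hms]
      rfl
    simp only [h2] at h1
    have h1' : -(ContinuousLinearMap.adjoint J (U t).snd) = -(ContinuousLinearMap.adjoint J w₀)
      + (∫ s in (0 : ℝ)..t, (U s).fst) + ∫ s in (0 : ℝ)..t,
        -(ContinuousLinearMap.adjoint J (memoryOp J M (fun s => (U s).fst) s + f s)) := h1
    have h3 := congrArg (innerSL ℝ v) h1'
    have hgi : IntervalIntegrable (fun s => memoryOp J M (fun s => (U s).fst) s + f s) volume 0 t :=
      (hmc2.intervalIntegrable _ _).add hf.intervalIntegrable
    have hgi2 : IntervalIntegrable (fun s => -(ContinuousLinearMap.adjoint J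
        (memoryOp J M (fun s => (U s).fst) s + f s))) volume 0 t :=
      ⟨(-(ContinuousLinearMap.adjoint J)).integrable_comp hgi.1,
        (-(ContinuousLinearMap.adjoint J)).integrable_comp hgi.2⟩
    rw [map_add, map_add, ← (innerSL ℝ v).intervalIntegral_comp_comm (hyc.intervalIntegrable _ _),
      ← (innerSL ℝ v).intervalIntegral_comp_comm hgi2] at h3
    simp only [innerSL_apply_apply, inner_neg_right, ContinuousLinearMap.adjoint_inner_right,
      inner_add_right] at h3
    have hi1 : IntervalIntegrable (fun s => inner ℝ (J v) (memoryOp J M (fun s => (U s).fst) s))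
        volume 0 t := (continuous_const.inner hmc2).intervalIntegrable _ _
    have hi2 : IntervalIntegrable (fun s => inner ℝ (J v) (f s)) volume 0 t :=
      (hf.const_inner (𝕜 := ℝ) (J v)).intervalIntegrable
    have hi3 : IntervalIntegrable (fun s => inner ℝ v (U s).fst) volume 0 t :=
      (continuous_const.inner hyc).intervalIntegrable _ _
    rw [intervalIntegral.integral_neg, intervalIntegral.integral_add hi1 hi2] at h3
    simp only [real_inner_comm v, real_inner_comm (J v)]
    rw [intervalIntegral.integral_sub hi3 hi1]
    linarith

theorem wave_eq_zero (hinj : Function.Injective J)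
    (hM : Continuous fun p : ℝ × ℝ => M p.1 p.2) {T : ℝ} {y : ℝ → V} {w : ℝ → H}
    (hy : Continuous y) (hw : Continuous w)
    (hyw : ∀ t ∈ Icc 0 T, J (y t) = ∫ s in (0 : ℝ)..t, w s)
    (heq : ∀ t ∈ Icc 0 T, ∀ v, inner ℝ (w t) (J v)
      + ∫ s in (0 : ℝ)..t, (inner ℝ (y s) v - inner ℝ (memoryOp J M y s) (J v)) = 0) :
    ∀ t ∈ Icc 0 T, y t = 0 := by
  intro t ht
  have hT : 0 ≤ T := ht.1.trans ht.2
  obtain ⟨m, hm⟩ := (isCompact_Icc.prod isCompact_Icc).exists_bound_of_continuousOn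
    (s := Icc (0 : ℝ) T ×ˢ Icc (0 : ℝ) T) hM.continuousOn
  have hm0 : 0 ≤ m := (norm_nonneg _).trans (hm (0, 0) ⟨⟨le_rfl, hT⟩, ⟨le_rfl, hT⟩⟩)
  have hm' : ∀ s ∈ Icc 0 T, ∀ r ∈ Icc 0 T, |M s r| ≤ m := fun s hs r hr => hm (s, r) ⟨hs, hr⟩
  have hmc : Continuous (memoryOp J M y) := continuous_memoryOp hM hy
  have hadj : Continuous fun s => ContinuousLinearMap.adjoint J (memoryOp J M y s) := by fun_prop
  have hadjn : Continuous fun s => -(ContinuousLinearMap.adjoint J (memoryOp J M y s)) := hadj.neg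
  set fstL := WithLp.fstL 2 ℝ V H
  set sndL := WithLp.sndL 2 ℝ V H
  have htoLp : Continuous (WithLp.toLp 2 : V × H → WithLp 2 (V × H)) :=
    (WithLp.prodContinuousLinearEquiv 2 ℝ V H).symm.continuous
  set D : ℝ → WithLp 2 (V × H) := fun s => WithLp.toLp 2 (y s, w s) with hD
  set n : ℝ → WithLp 2 (V × H) := fun s =>
    WithLp.toLp 2 (-(ContinuousLinearMap.adjoint J (memoryOp J M y s)), 0) with hn
  have hDc : Continuous D := htoLp.comp (hy.prodMk hw)
  have hnc : Continuous n := htoLp.comp (hadjn.prodMk continuous_const)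
  -- The memory term depends on y only through J y, the second component of K D. This is what lets
  -- the weak energy ‖K D‖ control it.
  have hJD : ∀ s, ‖J (y s)‖ ≤ ‖waveInverse J (D s)‖ := fun s => by
    refine le_of_sq_le_sq ?_ (norm_nonneg _)
    rw [WithLp.prod_norm_sq_eq_of_L2]
    have : (waveInverse J (D s)).snd = J (y s) := rfl
    rw [this]
    linarith [sq_nonneg ‖(waveInverse J (D s)).fst‖]
  have key := (isSkew_waveInverse J).eq_zero_of_integral_eq
    (c := ‖ContinuousLinearMap.adjoint J‖ * (1 + m * T)) (T := T) (by positivity) hDc hnc ?_ ?_ t ht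
  · have h1 : J (y t) = 0 := congrArg WithLp.snd key
    exact hinj (by rw [h1, map_zero])
  · intro t ht
    refine (WithLp.equiv 2 (V × H)).injective (Prod.ext ?_ ?_)
    · change -(ContinuousLinearMap.adjoint J (w t))
        = fstL (∫ s in (0 : ℝ)..t, D s) + fstL (∫ s in (0 : ℝ)..t, n s)
      rw [← fstL.intervalIntegral_comp_comm (hDc.intervalIntegrable _ _),
        ← fstL.intervalIntegral_comp_comm (hnc.intervalIntegrable _ _)]
      change _ = (∫ s in (0 : ℝ)..t, y s)
        + ∫ s in (0 : ℝ)..t, -(ContinuousLinearMap.adjoint J (memoryOp J M y s))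
      refine ext_inner_left ℝ fun v => ?_
      rw [inner_add_right, ← innerSL_apply_apply ℝ v (∫ s in (0 : ℝ)..t, y s),
        ← innerSL_apply_apply ℝ v (∫ s in (0 : ℝ)..t, -_),
        ← (innerSL ℝ v).intervalIntegral_comp_comm (hy.intervalIntegrable _ _),
        ← (innerSL ℝ v).intervalIntegral_comp_comm (hadjn.intervalIntegrable _ _)]
      simp only [innerSL_apply_apply, inner_neg_right, ContinuousLinearMap.adjoint_inner_right]
      have h := heq t ht v
      have hi1 : IntervalIntegrable (fun s => inner ℝ (J v) (memoryOp J M y s))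
        volume 0 t := (continuous_const.inner hmc).intervalIntegrable _ _
      have hi3 : IntervalIntegrable (fun s => inner ℝ v (y s)) volume 0 t :=
        (continuous_const.inner hy).intervalIntegrable _ _
      simp only [real_inner_comm v, real_inner_comm (J v)] at h
      rw [intervalIntegral.integral_sub hi3 hi1] at h
      rw [intervalIntegral.integral_neg]
      linarith
    · change J (y t) = sndL (∫ s in (0 : ℝ)..t, D s) + sndL (∫ s in (0 : ℝ)..t, n s)
      rw [← sndL.intervalIntegral_comp_comm (hDc.intervalIntegrable _ _),
        ← sndL.intervalIntegral_comp_comm (hnc.intervalIntegrable _ _), hyw t ht]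
      change _ = (∫ s in (0 : ℝ)..t, w s) + ∫ s in (0 : ℝ)..t, (0 : H)
      rw [intervalIntegral.integral_zero, add_zero]
  · intro l a hl ha t ht hb
    have h1 : ‖n t‖ = ‖ContinuousLinearMap.adjoint J (memoryOp J M y t)‖ := by
      rw [hn, WithLp.prod_norm_eq_of_L2]
      simp
    rw [h1]
    refine (ContinuousLinearMap.le_opNorm _ _).trans ?_
    rw [mul_assoc, mul_assoc]
    refine mul_le_mul_of_nonneg_left ?_ (norm_nonneg _)
    rw [← mul_assoc]
    exact norm_memoryOp_le hl ha hm0 hm' ht fun s hs => (hJD s).trans (hb s hs)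

end AbstractWave

/-! ### Injectivity and density of the inclusion of H₀¹(Ω) in L²(Ω). -/

section Sobolev

open MemoryWave

variable {d : ℕ} {Ω : Set (Space d)}

instance : CompleteSpace (H01 Ω) :=
  (Submodule.isClosed_topologicalClosure _).completeSpace_coe

/-- `toL2` as a continuous linear map. -/
noncomputable def toL2L (Ω : Set (Space d)) : H01 Ω →L[ℝ] L2 Ω :=
  WithLp.fstL 2 ℝ (L2 Ω) (L2Vec Ω) ∘L (H01 Ω).subtypeL

theorem toL2L_apply (f : H01 Ω) : toL2L Ω f = toL2 f := rfl

theorem inner_H01 (f g : H01 Ω) :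
    inner ℝ f g = inner ℝ (toL2 f) (toL2 g) + inner ℝ (weakGrad f) (weakGrad g) := rfl

namespace MemoryWave.IsTestFunction

variable {φ : Space d → ℝ}

theorem eq_zero (hφ : IsTestFunction Ω φ) {x : Space d} (hx : x ∉ Ω) : φ x = 0 :=
  image_eq_zero_of_notMem_tsupport fun h => hx (hφ.support_subset h)

theorem continuous_fderiv (hφ : IsTestFunction Ω φ) : Continuous (fderiv ℝ φ) :=
  hφ.smooth.continuous_fderiv (by simp)

theorem memLp (hφ : IsTestFunction Ω φ) : MemLp φ 2 (volume.restrict Ω) :=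
  (hφ.smooth.continuous.memLp_of_hasCompactSupport hφ.compact).restrict Ω

theorem memLp_smul (hφ : IsTestFunction Ω φ) (e : Space d) :
    MemLp (fun x => φ x • e) 2 (volume.restrict Ω) :=
  ((hφ.smooth.continuous.smul continuous_const).memLp_of_hasCompactSupport
    (hφ.compact.smul_right (f' := fun _ => e))).restrict Ω

theorem memLp_fderiv (hφ : IsTestFunction Ω φ) (e : Space d) :
    MemLp (fun x => fderiv ℝ φ x e) 2 (volume.restrict Ω) :=
  (((hφ.continuous_fderiv).clm_apply continuous_const).memLp_of_hasCompactSupport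
    (hφ.compact.fderiv_apply ℝ e)).restrict Ω

theorem memLp_gradient (hφ : IsTestFunction Ω φ) :
    MemLp (gradient φ) 2 (volume.restrict Ω) := by
  refine (Continuous.memLp_of_hasCompactSupport (μ := volume)
    ((InnerProductSpace.toDual ℝ (Space d)).symm.continuous.comp hφ.continuous_fderiv)
    ?_).restrict Ω
  exact (hφ.compact.fderiv ℝ).comp_left (g := (InnerProductSpace.toDual ℝ (Space d)).symm)
    (map_zero _)

/-- The pair `(φ, ∇φ)`. -/
noncomputable def pair (hφ : IsTestFunction Ω φ) : L2Pair Ω :=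
  WithLp.toLp 2 (hφ.memLp.toLp φ, hφ.memLp_gradient.toLp (gradient φ))

theorem pair_mem (hφ : IsTestFunction Ω φ) : hφ.pair ∈ H01 Ω :=
  Submodule.le_topologicalClosure _
    ⟨φ, hφ, hφ.memLp.coeFn_toLp, hφ.memLp_gradient.coeFn_toLp⟩

/-- Integration by parts on `H₀¹(Ω)` against a test function. -/
theorem inner_weakGrad (hφ : IsTestFunction Ω φ) (e : Space d) (p : L2Pair Ω)
    (hp : p ∈ H01 Ω) :
    inner ℝ ((hφ.memLp_smul e).toLp _) p.snd + inner ℝ ((hφ.memLp_fderiv e).toLp _) p.fst = 0 := by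
  -- The identity is a closed condition, so it suffices to check pairs (ψ, ∇ψ). Both functions
  -- vanish off Ω, hence the integrals extend to ℝ^d and no boundary term arises.
  have hclosed : IsClosed {p : L2Pair Ω | inner ℝ ((hφ.memLp_smul e).toLp _) p.snd
      + inner ℝ ((hφ.memLp_fderiv e).toLp _) p.fst = 0} := by
    refine isClosed_eq (Continuous.add ?_ ?_) continuous_const
    · exact continuous_const.inner (WithLp.sndL 2 ℝ (L2 Ω) (L2Vec Ω)).continuous
    · exact continuous_const.inner (WithLp.fstL 2 ℝ (L2 Ω) (L2Vec Ω)).continuous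
  refine closure_minimal ?_ hclosed hp
  rintro q ⟨ψ, hψ, h1, h2⟩
  simp only [mem_ofPred_eq, L2.inner_def]
  have e1 : ∫ x, inner ℝ ((hφ.memLp_smul e).toLp _ x) (q.snd x) ∂(volume.restrict Ω)
      = ∫ x, fderiv ℝ ψ x e * φ x := by
    rw [← setIntegral_eq_integral_of_forall_compl_eq_zero (s := Ω)
      (f := fun x => fderiv ℝ ψ x e * φ x) fun x hx => by rw [hφ.eq_zero hx, mul_zero]]
    refine integral_congr_ae ?_
    filter_upwards [h2, (hφ.memLp_smul e).coeFn_toLp] with x hx hx'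
    rw [hx, hx', real_inner_smul_left, real_inner_comm, gradient,
      InnerProductSpace.toDual_symm_apply, mul_comm]
  have e2 : ∫ x, inner ℝ ((hφ.memLp_fderiv e).toLp _ x) (q.fst x) ∂(volume.restrict Ω)
      = ∫ x, ψ x * fderiv ℝ φ x e := by
    rw [← setIntegral_eq_integral_of_forall_compl_eq_zero (s := Ω)
      (f := fun x => ψ x * fderiv ℝ φ x e) fun x hx => by rw [hψ.eq_zero hx, zero_mul]]
    refine integral_congr_ae ?_
    filter_upwards [h1, (hφ.memLp_fderiv e).coeFn_toLp] with x hx hx'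
    rw [hx, hx']
    rfl
  rw [e1, e2, integral_mul_fderiv_eq_neg_fderiv_mul_of_integrable]
  · ring
  · exact (((hψ.continuous_fderiv).clm_apply continuous_const).mul
      hφ.smooth.continuous).integrable_of_hasCompactSupport (hφ.compact.mul_left)
  · exact (hψ.smooth.continuous.mul
      ((hφ.continuous_fderiv).clm_apply continuous_const)).integrable_of_hasCompactSupport
      (hψ.compact.mul_right)
  · exact (hψ.smooth.continuous.mul hφ.smooth.continuous).integrable_of_hasCompactSupport
      (hψ.compact.mul_right)
  · exact fun x _ => hψ.smooth.differentiable (by simp) x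
  · exact fun x _ => hφ.smooth.differentiable (by simp) x

end MemoryWave.IsTestFunction

/-- The fundamental lemma of the calculus of variations in `L²(Ω; F)`. -/
theorem Lp_eq_zero_of_integral_testFunction {F : Type*} [NormedAddCommGroup F] [NormedSpace ℝ F]
    [CompleteSpace F] (hΩ : IsOpen Ω) (hb : Bornology.IsBounded Ω)
    (g : Lp F 2 (volume.restrict Ω))
    (h : ∀ φ : Space d → ℝ, IsTestFunction Ω φ → ∫ x in Ω, φ x • g x = 0) : g = 0 := by
  have hfin : IsFiniteMeasure (volume.restrict Ω) := ⟨by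
    rw [Measure.restrict_apply_univ]
    exact hb.measure_lt_top⟩
  have hint : IntegrableOn g Ω := (Lp.memLp g).integrable (by norm_num)
  have h1 := hΩ.ae_eq_zero_of_integral_contDiff_smul_eq_zero (f := g) (μ := volume)
    hint.locallyIntegrableOn fun φ h1 h2 h3 => by
      have hφ : IsTestFunction Ω φ := ⟨h1, h2, h3⟩
      rw [← h φ hφ, setIntegral_eq_integral_of_forall_compl_eq_zero]
      exact fun x hx => by rw [hφ.eq_zero hx, zero_smul]
  rw [Lp.eq_zero_iff_ae_eq_zero]
  exact (ae_restrict_iff' hΩ.measurableSet).2 h1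

/-- An element of H₀¹(Ω) carries its gradient as separate data. Integration by parts shows that the
gradient is determined by the function, so it vanishes when the function does. -/
theorem injective_toL2L (hΩ : IsOpen Ω) (hb : Bornology.IsBounded Ω) :
    Function.Injective (toL2L Ω) := by
  rw [injective_iff_map_eq_zero]
  rintro ⟨p, hp⟩ h
  have h1 : p.fst = 0 := h
  have h2 : p.snd = 0 := by
    refine Lp_eq_zero_of_integral_testFunction hΩ hb _ fun φ hφ => ext_inner_left ℝ fun e => ?_
    have hfin : IsFiniteMeasure (volume.restrict Ω) := ⟨by
      rw [Measure.restrict_apply_univ]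
      exact hb.measure_lt_top⟩
    have hi : Integrable (fun x => φ x • p.snd x) (volume.restrict Ω) :=
      memLp_one_iff_integrable.1 ((Lp.memLp p.snd).smul hφ.memLp)
    have h3 := hφ.inner_weakGrad e p hp
    rw [h1, inner_zero_right, add_zero, L2.inner_def] at h3
    rw [inner_zero_right, ← h3, ← integral_inner hi]
    refine integral_congr_ae ?_
    filter_upwards [(hφ.memLp_smul e).coeFn_toLp] with x hx
    rw [hx, real_inner_smul_left, real_inner_smul_right]
  exact Subtype.ext ((WithLp.equiv 2 (L2 Ω × L2Vec Ω)).injective (Prod.ext h1 h2))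

theorem denseRange_toL2L (hΩ : IsOpen Ω) (hb : Bornology.IsBounded Ω) :
    DenseRange (toL2L Ω) := by
  have h : (LinearMap.range (toL2L Ω : H01 Ω →ₗ[ℝ] L2 Ω)).topologicalClosure = ⊤ := by
    rw [Submodule.topologicalClosure_eq_top_iff, Submodule.eq_bot_iff]
    intro g hg
    refine Lp_eq_zero_of_integral_testFunction hΩ hb g fun φ hφ => ?_
    have h1 : inner ℝ (hφ.memLp.toLp φ) g = 0 := hg _ ⟨⟨hφ.pair, hφ.pair_mem⟩, rfl⟩
    rw [L2.inner_def] at h1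
    rw [← h1]
    refine integral_congr_ae ?_
    filter_upwards [hφ.memLp.coeFn_toLp] with x hx
    rw [hx, smul_eq_mul, mul_comm]
    rfl
  rw [← Submodule.dense_iff_topologicalClosure_eq_top] at h
  exact h

end Sobolev

/-! ### The control as an integrable curve in L²(Ω). -/

section Forcing

open scoped ENNReal

/-- By the Lindelöf property every open set is a countable union of balls, whose preimages are
sublevel sets of distances. -/
theorem measurable_of_measurable_edist {α X : Type*} [MeasurableSpace α] [PseudoEMetricSpace X]
    [SecondCountableTopology X] [MeasurableSpace X] [BorelSpace X] {f : α → X}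
    (h : ∀ c, Measurable fun s => edist (f s) c) : Measurable f := by
  refine measurable_of_isOpen fun U hU => ?_
  have h1 : ∀ x ∈ U, ∃ r : ℝ≥0∞, 0 < r ∧ Metric.eball x r ⊆ U := fun x hx =>
    EMetric.isOpen_iff.1 hU x hx
  choose! r hr0 hr using h1
  obtain ⟨A, hAU, hAc, hA⟩ := TopologicalSpace.isOpen_biUnion_countable U
    (fun x => Metric.eball x (r x)) fun x _ => Metric.isOpen_eball
  have h2 : U = ⋃ x ∈ A, Metric.eball x (r x) := by
    rw [hA]
    exact Subset.antisymm (fun x hx => mem_iUnion₂.2 ⟨x, hx, Metric.mem_eball_self (hr0 x hx)⟩)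
      (iUnion₂_subset hr)
  rw [h2, preimage_iUnion₂]
  refine MeasurableSet.biUnion hAc fun x _ => ?_
  exact measurableSet_lt (h x) measurable_const

variable {α X : Type*} [MeasurableSpace α] [MeasurableSpace X] {μ : Measure X}

theorem eLpNorm_two_eq_lintegral (g : X → ℝ) :
    eLpNorm g 2 μ = (∫⁻ x, ‖g x‖ₑ ^ 2 ∂μ) ^ (1 / 2 : ℝ) := by
  rw [eLpNorm_eq_lintegral_rpow_enorm_toReal two_ne_zero ENNReal.ofNat_ne_top]
  simp

theorem measurable_eLpNorm_two_slice [SFinite μ] {g : α × X → ℝ} (hg : Measurable g) :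
    Measurable fun s => eLpNorm (fun x => g (s, x)) 2 μ := by
  simp only [eLpNorm_two_eq_lintegral]
  exact (Measurable.lintegral_prod_right' (f := fun p => ‖g p‖ₑ ^ 2) (by fun_prop)).pow_const _

/-- A measurable function of two variables is, slice by slice, a measurable curve in `L²`. -/
theorem exists_measurable_slices [SFinite μ] [IsSeparable μ] {g : α × X → ℝ}
    (hg : Measurable g) :
    ∃ f : α → Lp ℝ 2 μ, StronglyMeasurable f ∧
      (∀ s, MemLp (fun x => g (s, x)) 2 μ → f s =ᵐ[μ] fun x => g (s, x)) ∧
      ∀ s, ‖f s‖ₑ ≤ eLpNorm (fun x => g (s, x)) 2 μ := by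
  classical
  have hslice : ∀ s, Measurable fun x => g (s, x) := fun s => hg.comp measurable_prodMk_left
  -- Slices outside L² get the value 0, which keeps the norm bound valid for every s.
  set f : α → Lp ℝ 2 μ := fun s =>
    if h : MemLp (fun x => g (s, x)) 2 μ then h.toLp _ else 0 with hf
  have hf1 : ∀ s (h : MemLp (fun x => g (s, x)) 2 μ), f s = h.toLp _ := fun s h => dif_pos h
  have hf0 : ∀ s, ¬MemLp (fun x => g (s, x)) 2 μ → f s = 0 := fun s h => dif_neg h
  refine ⟨f, ?_, fun s h => ?_, fun s => ?_⟩
  · have : Fact ((2 : ℝ≥0∞) ≠ ⊤) := ⟨ENNReal.ofNat_ne_top⟩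
    let _ : MeasurableSpace (Lp ℝ 2 μ) := borel _
    have : BorelSpace (Lp ℝ 2 μ) := ⟨rfl⟩
    refine (measurable_of_measurable_edist fun c => ?_).stronglyMeasurable
    have hset : MeasurableSet {s | MemLp (fun x => g (s, x)) 2 μ} := by
      have : {s | MemLp (fun x => g (s, x)) 2 μ}
          = {s | eLpNorm (fun x => g (s, x)) 2 μ < ⊤} := by
        ext s
        exact ⟨fun h => h.2, fun h => ⟨(hslice s).aestronglyMeasurable, h⟩⟩
      rw [this]
      exact measurableSet_lt (measurable_eLpNorm_two_slice hg) measurable_const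
    have hc : Measurable fun p : α × X => g p - c p.2 :=
      hg.sub ((Lp.stronglyMeasurable c).measurable.comp measurable_snd)
    have heq : (fun s => edist (f s) c) = fun s => if MemLp (fun x => g (s, x)) 2 μ
        then eLpNorm (fun x => g (s, x) - c x) 2 μ else edist 0 c := by
      funext s
      split_ifs with h
      · rw [hf1 s h, Lp.edist_def]
        refine eLpNorm_congr_ae ?_
        filter_upwards [h.coeFn_toLp] with x hx
        rw [Pi.sub_apply, hx]
      · rw [hf0 s h]
    rw [heq]
    have hm := measurable_eLpNorm_two_slice (μ := μ) hc
    exact Measurable.ite hset hm measurable_const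
  · rw [hf1 s h]
    exact h.coeFn_toLp
  · by_cases h : MemLp (fun x => g (s, x)) 2 μ
    · rw [hf1 s h, Lp.enorm_toLp]
    · rw [hf0 s h]
      simp

open MemoryWave

/-- By Tonelli almost every slice of u, extended by zero, lies in L²(Ω). Cauchy–Schwarz in time
gives the factor √T. -/
theorem exists_forcing {d : ℕ} {Ω : Set (Space d)} {T : ℝ} (hT : 0 ≤ T)
    {O : ℝ → Set (Space d)} (hO : ∀ t ∈ Ioo 0 T, O t ⊆ Ω)
    (hR : MeasurableSet (controlRegion T O))
    (u : Lp ℝ 2 (volume.restrict (controlRegion T O))) :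
    ∃ f : ℝ → L2 Ω, Integrable f ∧ ∫ s, ‖f s‖ ≤ Real.sqrt T * ‖u‖ ∧
      ∀ v : L2 Ω, ∀ t ∈ Icc 0 T,
        ∫ s in (0 : ℝ)..t, inner ℝ (f s) v = ∫ s in (0 : ℝ)..t, ∫ x in O s, u (s, x) * v x := by
  set g : ℝ × Space d → ℝ := (controlRegion T O).indicator u with hg
  have hgm : Measurable g := (Lp.stronglyMeasurable u).measurable.indicator hR
  obtain ⟨f, hfm, hf, hfn⟩ := exists_measurable_slices (μ := volume.restrict Ω) hgm
  have hgz : ∀ s ∉ Ioo 0 T, ∀ x, g (s, x) = 0 := fun s hs x =>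
    indicator_of_notMem (fun h => hs h.1) _
  have hfz : ∀ s ∉ Ioo 0 T, f s = 0 := fun s hs => by
    have := hfn s
    simp only [hgz s hs, eLpNorm_zero'] at this
    simpa using this
  have htot : ∫⁻ s, ∫⁻ x in Ω, ‖g (s, x)‖ₑ ^ 2 ≤ ‖u‖ₑ ^ 2 := by
    calc ∫⁻ s, ∫⁻ x in Ω, ‖g (s, x)‖ₑ ^ 2 ≤ ∫⁻ s, ∫⁻ x, ‖g (s, x)‖ₑ ^ 2 :=
          lintegral_mono fun s => setLIntegral_le_lintegral _ _
      _ = ∫⁻ p : ℝ × Space d, ‖g p‖ₑ ^ 2 := by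
          rw [Measure.volume_eq_prod, lintegral_prod _ (by fun_prop)]
      _ = ∫⁻ p in controlRegion T O, ‖u p‖ₑ ^ 2 := by
          rw [← lintegral_indicator hR]
          refine lintegral_congr fun p => ?_
          by_cases hp : p ∈ controlRegion T O <;> simp [hg, hp]
      _ = ‖u‖ₑ ^ 2 := by
          rw [Lp.enorm_def, eLpNorm_two_eq_lintegral, ← ENNReal.rpow_natCast, ← ENNReal.rpow_mul]
          simp
  have hsq : ∀ s, eLpNorm (fun x => g (s, x)) 2 (volume.restrict Ω) ^ 2
      = ∫⁻ x in Ω, ‖g (s, x)‖ₑ ^ 2 := fun s => by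
    rw [eLpNorm_two_eq_lintegral, ← ENNReal.rpow_natCast, ← ENNReal.rpow_mul]
    simp
  have hf2 : ∫⁻ s, ‖f s‖ₑ ^ 2 ≤ ‖u‖ₑ ^ 2 := by
    refine le_trans (lintegral_mono fun s => ?_) htot
    rw [← hsq]
    gcongr
    exact hfn s
  have hmem : ∀ᵐ s, MemLp (fun x => g (s, x)) 2 (volume.restrict Ω) := by
    have hm : Measurable fun s => ∫⁻ x in Ω, ‖g (s, x)‖ₑ ^ 2 :=
      Measurable.lintegral_prod_right' (f := fun p => ‖g p‖ₑ ^ 2) (by fun_prop)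
    filter_upwards [ae_lt_top hm (htot.trans_lt (by simp)).ne] with s hs
    refine ⟨(hgm.comp measurable_prodMk_left).aestronglyMeasurable, ?_⟩
    rw [← hsq] at hs
    simpa using hs
  have hf1 : ∫⁻ s, ‖f s‖ₑ ≤ ENNReal.ofReal (Real.sqrt T * ‖u‖) := by
    have h1 : ∫⁻ s, ‖f s‖ₑ = eLpNorm f 1 (volume.restrict (Ioo 0 T)) := by
      rw [eLpNorm_one_eq_lintegral_enorm, ← lintegral_indicator measurableSet_Ioo]
      refine lintegral_congr fun s => ?_
      by_cases hs : s ∈ Ioo 0 T <;> simp [hs, hfz]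
    rw [h1]
    refine (eLpNorm_le_eLpNorm_mul_rpow_measure_univ (q := 2) (by norm_num)
      hfm.aestronglyMeasurable).trans ?_
    have h2 : eLpNorm f 2 (volume.restrict (Ioo 0 T)) ≤ ‖u‖ₑ := by
      rw [eLpNorm_eq_lintegral_rpow_enorm_toReal two_ne_zero ENNReal.ofNat_ne_top]
      have h3 : ∫⁻ s in Ioo 0 T, ‖f s‖ₑ ^ (2 : ℝ≥0∞).toReal ≤ ‖u‖ₑ ^ 2 := by
        refine (setLIntegral_le_lintegral _ _).trans (le_of_eq_of_le ?_ hf2)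
        simp
      refine (ENNReal.rpow_le_rpow h3 (by simp)).trans (le_of_eq ?_)
      rw [← ENNReal.rpow_natCast, ← ENNReal.rpow_mul]
      simp
    have h4 : volume.restrict (Ioo 0 T) univ ^ (1 / (1 : ℝ≥0∞).toReal - 1 / (2 : ℝ≥0∞).toReal)
        = ENNReal.ofReal (Real.sqrt T) := by
      rw [Measure.restrict_apply_univ, Real.volume_Ioo, sub_zero, Real.sqrt_eq_rpow,
        ENNReal.ofReal_rpow_of_nonneg hT (by simp; norm_num)]
      norm_num
    rw [h4, mul_comm, ENNReal.ofReal_mul (Real.sqrt_nonneg _), ofReal_norm]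
    gcongr
  have hfi : Integrable f := ⟨hfm.aestronglyMeasurable, hf1.trans_lt ENNReal.ofReal_lt_top⟩
  refine ⟨f, hfi, ?_, fun v t ht => ?_⟩
  · rw [integral_norm_eq_lintegral_enorm hfm.aestronglyMeasurable]
    exact ENNReal.toReal_le_of_le_ofReal (by positivity) hf1
  · refine intervalIntegral.integral_congr_ae ?_
    -- The region lives over the open interval (0, T), while integration up to t = T includes the
    -- endpoint, a null set.
    have hTne : ∀ᵐ s : ℝ, s ≠ T := by simp [ae_iff]
    filter_upwards [hmem, hTne] with s hs hsT hst
    rw [uIoc_of_le ht.1] at hst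
    have hs0 : s ∈ Ioo 0 T := ⟨hst.1, lt_of_le_of_ne (hst.2.trans ht.2) hsT⟩
    have hOm : MeasurableSet (O s) := by
      have h1 : O s = Prod.mk s ⁻¹' controlRegion T O := by
        ext x
        exact ⟨fun hx => ⟨hs0, hx⟩, fun hx => hx.2⟩
      rw [h1]
      exact measurable_prodMk_left hR
    rw [L2.inner_def]
    have h2 : ∫ x in Ω, inner ℝ (f s x) (v x)
        = ∫ x in Ω, (O s).indicator (fun x => u (s, x) * v x) x := by
      refine integral_congr_ae ?_
      filter_upwards [hf s hs] with x hx
      rw [hx]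
      by_cases hxO : x ∈ O s
      · have h3 : g (s, x) = u (s, x) :=
          indicator_of_mem (show (s, x) ∈ controlRegion T O from ⟨hs0, hxO⟩) _
        rw [indicator_of_mem hxO, h3, mul_comm]
        rfl
      · have h3 : g (s, x) = 0 := indicator_of_notMem (fun h => hxO h.2) _
        rw [indicator_of_notMem hxO, h3, inner_zero_left]
    rw [h2, setIntegral_indicator hOm, inter_eq_right.2 (hO s hs0)]

end Forcing

/-! ### Translation between weak solutions and the abstract equation. -/

section Solutions

open MemoryWave

variable {d : ℕ} {Ω : Set (Space d)} {T : ℝ} {M : ℝ → ℝ → ℝ}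

/-- The continuous extension of a kernel on `[0,T]²` to the plane. -/
noncomputable def extendKernel (hT : 0 ≤ T) (M : ℝ → ℝ → ℝ) (s r : ℝ) : ℝ :=
  M (projIcc 0 T hT s) (projIcc 0 T hT r)

theorem continuous_extendKernel (hT : 0 ≤ T)
    (hM : ContinuousOn (fun p : ℝ × ℝ => M p.1 p.2) (Icc 0 T ×ˢ Icc 0 T)) :
    Continuous fun p : ℝ × ℝ => extendKernel hT M p.1 p.2 := by
  refine hM.comp_continuous (f := fun p : ℝ × ℝ =>
    ((projIcc 0 T hT p.1 : ℝ), (projIcc 0 T hT p.2 : ℝ))) ?_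
    fun p => ⟨Subtype.prop _, Subtype.prop _⟩
  exact (continuous_subtype_val.comp (continuous_projIcc.comp continuous_fst)).prodMk
    (continuous_subtype_val.comp (continuous_projIcc.comp continuous_snd))

theorem memoryOp_extendKernel (hT : 0 ≤ T) {y Y : ℝ → H01 Ω} (hY : EqOn Y y (Icc 0 T)) {s : ℝ}
    (hs : s ∈ Icc 0 T) :
    memoryOp (toL2L Ω) (extendKernel hT M) Y s
      = toL2 (y s) - ∫ r in (0 : ℝ)..s, M s r • toL2 (y r) := by
  rw [memoryOp, toL2L_apply, hY hs]
  congr 1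
  refine intervalIntegral.integral_congr fun r hr => ?_
  rw [uIcc_of_le hs.1] at hr
  have hr' : r ∈ Icc 0 T := ⟨hr.1, hr.2.trans hs.2⟩
  simp only [extendKernel, projIcc_of_mem hT hs, projIcc_of_mem hT hr', toL2L_apply, hY hr']

/-- The L² product ⟨y, v⟩ is added to complete the H₀¹ inner product and subtracted again through
the memory operator. -/
theorem integral_weakForm (hT : 0 ≤ T) {y Y : ℝ → H01 Ω} (hY : EqOn Y y (Icc 0 T)) (v : H01 Ω)
    {t : ℝ} (ht : t ∈ Icc 0 T) :
    (∫ s in (0 : ℝ)..t, (inner ℝ (weakGrad (y s)) (weakGrad v)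
          + inner ℝ (∫ r in (0 : ℝ)..s, M s r • toL2 (y r)) (toL2 v)))
      = ∫ s in (0 : ℝ)..t, (inner ℝ (Y s) v
          - inner ℝ (memoryOp (toL2L Ω) (extendKernel hT M) Y s) (toL2L Ω v)) := by
  refine intervalIntegral.integral_congr fun s hs => ?_
  rw [uIcc_of_le ht.1] at hs
  have hs' : s ∈ Icc 0 T := ⟨hs.1, hs.2.trans ht.2⟩
  simp only [memoryOp_extendKernel hT hY hs', toL2L_apply, inner_sub_left, inner_H01, hY hs']
  ring

section

variable {y : ℝ → H01 Ω} {w : ℝ → L2 Ω} {b : L2 Ω}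

theorem hasDerivWithinAt_of_integral (hw : Continuous w)
    (h : ∀ t ∈ Icc 0 T, toL2 (y t) = b + ∫ s in (0 : ℝ)..t, w s) {t : ℝ} (ht : t ∈ Icc 0 T) :
    HasDerivWithinAt (fun s => toL2 (y s)) (w t) (Icc 0 T) t :=
  ((hw.integral_hasStrictDerivAt 0 t).hasDerivAt.const_add b).hasDerivWithinAt.congr h (h t ht)

theorem velocity_of_integral (hT : 0 < T) (hw : Continuous w)
    (h : ∀ t ∈ Icc 0 T, toL2 (y t) = b + ∫ s in (0 : ℝ)..t, w s) {t : ℝ} (ht : t ∈ Icc 0 T) :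
    velocity T y t = w t :=
  (hasDerivWithinAt_of_integral hw h ht).derivWithin (uniqueDiffOn_Icc hT t ht)

theorem contDiffOn_of_integral (hw : Continuous w)
    (h : ∀ t ∈ Icc 0 T, toL2 (y t) = b + ∫ s in (0 : ℝ)..t, w s) :
    ContDiffOn ℝ 1 (fun t => toL2 (y t)) (Icc 0 T) := by
  have hd : ∀ t, HasDerivAt (fun t => b + ∫ s in (0 : ℝ)..t, w s) (w t) t := fun t =>
    (hw.integral_hasStrictDerivAt 0 t).hasDerivAt.const_add b
  have h1 : ContDiff ℝ 1 fun t => b + ∫ s in (0 : ℝ)..t, w s := by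
    rw [contDiff_one_iff_deriv]
    refine ⟨fun t => (hd t).differentiableAt, ?_⟩
    rwa [show deriv (fun t => b + ∫ s in (0 : ℝ)..t, w s) = w from funext fun t => (hd t).deriv]
  exact h1.contDiffOn.congr h

end

namespace MemoryWave.IsSolution

variable {O : ℝ → Set (Space d)} {y₀ : H01 Ω} {y₁ : L2 Ω}
  {u : Lp ℝ 2 (volume.restrict (controlRegion T O))} {y z : ℝ → H01 Ω}

theorem continuousOn_velocity (h : IsSolution Ω T M O y₀ y₁ u y) (hT : 0 < T) :
    ContinuousOn (velocity T y) (Icc 0 T) :=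
  h.contDiffOn.continuousOn_derivWithin (uniqueDiffOn_Icc hT) le_rfl

theorem toL2_eq_integral (h : IsSolution Ω T M O y₀ y₁ u y) (hT : 0 < T) {t : ℝ}
    (ht : t ∈ Icc 0 T) : toL2 (y t) = toL2 y₀ + ∫ s in (0 : ℝ)..t, velocity T y s := by
  have hsub : Icc 0 t ⊆ Icc 0 T := Icc_subset_Icc_right ht.2
  have h1 := intervalIntegral.integral_eq_sub_of_hasDerivAt_of_le ht.1
    (f := fun s => toL2 (y s)) (f' := velocity T y) (h.contDiffOn.continuousOn.mono hsub)
    (fun s hs => ?_) ?_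
  · rw [h1, h.initial_position]
    abel
  · have hs' : s ∈ Ioo 0 T := ⟨hs.1, hs.2.trans_le ht.2⟩
    exact ((h.contDiffOn.differentiableOn (by simp) s
      (Ioo_subset_Icc_self hs')).hasDerivWithinAt).hasDerivAt (Icc_mem_nhds hs'.1 hs'.2)
  · refine ContinuousOn.intervalIntegrable ?_
    rw [uIcc_of_le ht.1]
    exact (h.continuousOn_velocity hT).mono hsub

theorem eqOn (hΩ : IsOpen Ω) (hb : Bornology.IsBounded Ω) (hT : 0 < T)
    (hM : ContinuousOn (fun p : ℝ × ℝ => M p.1 p.2) (Icc 0 T ×ˢ Icc 0 T))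
    (hz : IsSolution Ω T M O y₀ y₁ u z) (hy : IsSolution Ω T M O y₀ y₁ u y) :
    EqOn z y (Icc 0 T) := by
  have hK := continuous_extendKernel hT.le hM
  -- Solutions are constrained only on [0, T]. Clamping time makes them and their velocities
  -- continuous on ℝ, as the abstract uniqueness result requires.
  set π : ℝ → ℝ := fun t => projIcc 0 T hT.le t with hπ
  have hπm : ∀ t, π t ∈ Icc 0 T := fun t => Subtype.prop _
  have hπc : Continuous π := continuous_subtype_val.comp continuous_projIcc
  have hπe : ∀ t ∈ Icc 0 T, π t = t := fun t ht => by simp only [hπ, projIcc_of_mem hT.le ht]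
  have hc : ∀ {X : Type _} [TopologicalSpace X] {f : ℝ → X}, ContinuousOn f (Icc 0 T) →
      Continuous fun t => f (π t) := fun hf => hf.comp_continuous hπc hπm
  have hzc := hc hz.continuousOn
  have hyc := hc hy.continuousOn
  have hzw := hc (hz.continuousOn_velocity hT)
  have hyw := hc (hy.continuousOn_velocity hT)
  have hzE : EqOn (fun t => z (π t)) z (Icc 0 T) := fun t ht => by simp only [hπe t ht]
  have hyE : EqOn (fun t => y (π t)) y (Icc 0 T) := fun t ht => by simp only [hπe t ht]
  set D : ℝ → H01 Ω := fun t => z (π t) - y (π t) with hD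
  set w : ℝ → L2 Ω := fun t => velocity T z (π t) - velocity T y (π t) with hw
  have hDc : Continuous D := hzc.sub hyc
  have key := wave_eq_zero (toL2L Ω) (injective_toL2L hΩ hb) hK (T := T) (y := D) (w := w) hDc
    (hzw.sub hyw) (fun t ht => ?_) (fun t ht v => ?_)
  · intro t ht
    have h1 := key t ht
    simp only [hD, hπe t ht] at h1
    exact sub_eq_zero.1 h1
  · have h1 : ∫ s in (0 : ℝ)..t, w s = (∫ s in (0 : ℝ)..t, velocity T z s)
        - ∫ s in (0 : ℝ)..t, velocity T y s := by
      have h2 : ∀ {f : ℝ → L2 Ω}, ∫ s in (0 : ℝ)..t, f s = ∫ s in (0 : ℝ)..t, f (π s) := by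
        intro f
        refine intervalIntegral.integral_congr fun s hs => ?_
        rw [uIcc_of_le ht.1] at hs
        simp only [hπe s ⟨hs.1, hs.2.trans ht.2⟩]
      rw [h2 (f := velocity T z), h2 (f := velocity T y)]
      exact intervalIntegral.integral_sub (hzw.intervalIntegrable _ _)
        (hyw.intervalIntegrable _ _)
    rw [h1, map_sub, toL2L_apply, toL2L_apply, hπe t ht, hz.toL2_eq_integral hT ht,
      hy.toL2_eq_integral hT ht]
    abel
  · have ez := hz.equation v t ht
    have ey := hy.equation v t ht
    rw [hz.initial_velocity, integral_weakForm hT.le hzE v ht] at ez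
    rw [hy.initial_velocity, integral_weakForm hT.le hyE v ht, ← ez] at ey
    have hadd : ∀ s, memoryOp (toL2L Ω) (extendKernel hT.le M) (fun t => z (π t)) s
        = memoryOp (toL2L Ω) (extendKernel hT.le M) D s
          + memoryOp (toL2L Ω) (extendKernel hT.le M) (fun t => y (π t)) s := fun s => by
      rw [← memoryOp_add hK hDc hyc]
      simp only [hD, sub_add_cancel]
    have hint : ∀ {Y : ℝ → H01 Ω}, Continuous Y → IntervalIntegrable (fun s => inner ℝ (Y s) v
        - inner ℝ (memoryOp (toL2L Ω) (extendKernel hT.le M) Y s) (toL2L Ω v)) volume 0 t :=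
      fun hY => ((hY.inner continuous_const).sub
        ((continuous_memoryOp hK hY).inner continuous_const)).intervalIntegrable _ _
    have hsplit : ∀ s, inner ℝ (D s) v
        - inner ℝ (memoryOp (toL2L Ω) (extendKernel hT.le M) D s) (toL2L Ω v)
        = (inner ℝ (z (π s)) v - inner ℝ (memoryOp (toL2L Ω) (extendKernel hT.le M)
            (fun t => z (π t)) s) (toL2L Ω v))
          - (inner ℝ (y (π s)) v - inner ℝ (memoryOp (toL2L Ω) (extendKernel hT.le M)
            (fun t => y (π t)) s) (toL2L Ω v)) := fun s => by
      rw [hadd, inner_add_left, hD, inner_sub_left]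
      ring
    simp only [hsplit]
    rw [intervalIntegral.integral_sub (hint hzc) (hint hyc), hw]
    simp only [hπe t ht, inner_sub_left]
    simp only [toL2L_apply] at ey ⊢
    linarith

end MemoryWave.IsSolution

end Solutions

end

theorem proposition1p1 {d : ℕ} (Ω : Set (MemoryWave.Space d))
    (hΩ_open : IsOpen Ω) (hΩ_conn : IsConnected Ω) (hΩ_bdd : Bornology.IsBounded Ω)
    (T : ℝ) (hT : 0 < T)
    (M : ℝ → ℝ → ℝ) (hM : ContinuousOn (fun p : ℝ × ℝ => M p.1 p.2) (Icc 0 T ×ˢ Icc 0 T)) :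
    ∃ C : ℝ, 0 < C ∧
      ∀ O : ℝ → Set (MemoryWave.Space d), (∀ t ∈ Ioo 0 T, O t ⊆ Ω) →
        MeasurableSet (MemoryWave.controlRegion T O) →
      ∀ (y₀ : MemoryWave.H01 Ω) (y₁ : MemoryWave.L2 Ω)
        (u : Lp ℝ 2 (volume.restrict (MemoryWave.controlRegion T O))),
      ∃ y : ℝ → MemoryWave.H01 Ω,
        MemoryWave.IsSolution Ω T M O y₀ y₁ u y ∧
        (∀ z : ℝ → MemoryWave.H01 Ω,
          MemoryWave.IsSolution Ω T M O y₀ y₁ u z → EqOn z y (Icc 0 T)) ∧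
        MemoryWave.solutionNorm T y ≤ C * (Real.sqrt (‖y₀‖ ^ 2 + ‖y₁‖ ^ 2) + ‖u‖) := by
  obtain ⟨C, hC, hwave⟩ := exists_wave (toL2L Ω) (injective_toL2L hΩ_open hΩ_bdd)
    (denseRange_toL2L hΩ_open hΩ_bdd) (continuous_extendKernel hT.le hM) hT.le
  -- The factor 2 comes from √(B² + B²) ≤ 2B, and 1 + √T dominates both the coefficient 1 of the
  -- data and the coefficient √T of ‖u‖.
  refine ⟨2 * (C * (1 + Real.sqrt T)), by positivity, fun O hO hR y₀ y₁ u => ?_⟩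
  obtain ⟨f, hf, hfn, hfu⟩ := exists_forcing hT.le hO hR u
  obtain ⟨y, w, hyc, hwc, hy0, hw0, h⟩ := hwave y₀ y₁ f hf
  have hint : ∀ t ∈ Icc 0 T, MemoryWave.toL2 (y t)
      = MemoryWave.toL2 y₀ + ∫ s in (0 : ℝ)..t, w s := fun t ht => (h t ht).2.2.1
  have hvel : ∀ t ∈ Icc 0 T, MemoryWave.velocity T y t = w t := fun t ht =>
    velocity_of_integral hT hwc hint ht
  have h0 : (0 : ℝ) ∈ Icc 0 T := ⟨le_rfl, hT.le⟩
  have hsol : MemoryWave.IsSolution Ω T M O y₀ y₁ u y :=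
    { continuousOn := hyc.continuousOn
      contDiffOn := contDiffOn_of_integral hwc hint
      initial_position := hy0
      initial_velocity := (hvel 0 h0).trans hw0
      equation := fun v t ht => by
        rw [hvel t ht, hvel 0 h0, hw0, integral_weakForm hT.le (fun _ _ => rfl) v ht,
          ← hfu _ t ht]
        exact (h t ht).2.2.2 v }
  refine ⟨y, hsol, fun z hz => hz.eqOn hΩ_open hΩ_bdd hT hM hsol, ?_⟩
  set B : ℝ := C * (Real.sqrt (‖y₀‖ ^ 2 + ‖y₁‖ ^ 2) + ∫ s, ‖f s‖) with hB
  have hB0 : 0 ≤ B := (norm_nonneg _).trans (h 0 h0).1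
  have hne : Nonempty (Icc (0 : ℝ) T) := ⟨⟨0, h0⟩⟩
  have hs1 : (⨆ t : Icc (0 : ℝ) T, ‖y t‖) ≤ B := ciSup_le fun t => (h t t.2).1
  have hs2 : (⨆ t : Icc (0 : ℝ) T, ‖MemoryWave.velocity T y t‖) ≤ B := ciSup_le fun t => by
    rw [hvel t t.2]
    exact (h t t.2).2.1
  have hs10 : 0 ≤ ⨆ t : Icc (0 : ℝ) T, ‖y t‖ := Real.iSup_nonneg fun t => norm_nonneg _
  have hs20 : 0 ≤ ⨆ t : Icc (0 : ℝ) T, ‖MemoryWave.velocity T y t‖ :=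
    Real.iSup_nonneg fun t => norm_nonneg _
  have hN : MemoryWave.solutionNorm T y ≤ 2 * B := by
    refine Real.sqrt_le_iff.2 ⟨by positivity, ?_⟩
    nlinarith
  refine hN.trans ?_
  rw [mul_assoc, hB, mul_assoc]
  refine mul_le_mul_of_nonneg_left (mul_le_mul_of_nonneg_left ?_ hC.le) zero_le_two
  nlinarith [Real.sqrt_nonneg T, norm_nonneg u, Real.sqrt_nonneg (‖y₀‖ ^ 2 + ‖y₁‖ ^ 2),
    mul_nonneg (Real.sqrt_nonneg T) (Real.sqrt_nonneg (‖y₀‖ ^ 2 + ‖y₁‖ ^ 2))]
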